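/- Let $\mathcal H$ be a complex Hilbert space with an orthonormal basis $\{|n\rangle : n\in\mathbb N\}$, $\mathbb N=\{0,1,2,\dots\}$, let $a|n\rangle=\sqrt n\,|n-1\rangle$ and $a^*|n\rangle=\sqrt{n+1}\,|n+1\rangle$ be the lowering and raising operators, and let $D(z)=e^{za^*-\bar z a}$ ($z\in\mathbb C$) be the shift operators, i.e. the bounded (unitary) operators with $D(z)|n\rangle=\sum_{k\ge 0}\frac1{k!}(za^*-\bar za)^k|n\rangle$. Let $U(t)|n\rangle=t^n|n\rangle$ for $t\in\mathbb T=\{t\in\mathbb C:|t|=1\}$. An observable on a topological space $\Omega$ is a map $\mathsf E$ from the Borel sets of $\Omega$ to the bounded operators on $\mathcal H$ with $O\le\mathsf E(X)\le I$, $\mathsf E(\Omega)=I$, and $\mathsf E(\bigcup_i X_i)=\sum_i\mathsf E(X_i)$ in the weak operator topology for disjoint sequences of Borel sets. It is approximately sharp if $\|\mathsf E(X)\|=1$ for every open set $X$ with $\mathsf E(X)\ne O$. A phase observable is an observable on $\mathbb T$ with $U(t)\mathsf E(X)U(t)^*=\mathsf E(tX)$ for all $t\in\mathbb T$ and all Borel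 sets $X\subseteq\mathbb T$. A phase matrix of $\mathsf E$ is a positive semidefinite matrix $(c_{m,n})_{m,n\in\mathbb N}$ with $c_{n,n}=1$ for all $n$ and $$\langle m|\mathsf E(X)|n\rangle=c_{m,n}\int_{\arg X}e^{i(m-n)\theta}\,\frac{d\theta}{2\pi}\qquad\text{for all } m,n\in\mathbb N \text{ and all Borel } X\subseteq\mathbb T,$$ where $\arg X=\{\theta\in[0,2\pi):e^{i\theta}\in X\}$. **Proposition.** Let $T=\sum_{n=0}^\infty\lambda_n|n\rangle\langle n|$ with $\lambda_n\ge0$ and $\sum_n\lambda_n=1$ be a diagonal state. Then for every Borel set $X\subseteq\mathbb T$ the weak integral $$\mathsf E_T(X)=\frac1\pi\int_{\arg X}\int_0^\infty D(re^{i\theta})\,T\,D(re^{i\theta})^*\,r\,dr\,d\theta$$ exists as a bounded operator, and $\mathsf E_T$ is a phase observable. It is approximately sharp. Moreover, $\mathsf E_T$ has a phase matrix, and every phase matrix $(c^T_{m,n})$ of $\mathsf E_T$ satisfies $\lim_{m\to\infty}c^T_{m,m+k}=1$ for all $k\in\mathbb N$. -/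

import Mathlib

open scoped InnerProductSpace MeasureTheory ComplexOrder

namespace PhaseObs

/-! ### Observables -/

section Observables

variable {H : Type*} [NormedAddCommGroup H] [InnerProductSpace ℂ H] [CompleteSpace H]
variable {Ω : Type*} [TopologicalSpace Ω]

/-- A normalized positive operator valued measure on the Borel sets of `Ω`. The values of `E` on
non-Borel sets play no role. The order is the Loewner order, and the series converges in the weak
operator topology. -/
structure IsObservable (E : Set Ω → H →L[ℂ] H) : Prop where
  nonneg : ∀ X, MeasurableSet[borel Ω] X → 0 ≤ E X
  le_one : ∀ X, MeasurableSet[borel Ω] X → E X ≤ 1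
  univ : E Set.univ = 1
  iUnion : ∀ X : ℕ → Set Ω, (∀ i, MeasurableSet[borel Ω] (X i)) →
    Pairwise (fun i j => Disjoint (X i) (X j)) →
    HasSum (fun i => ContinuousLinearMapWOT.ofCLM (E (X i)))
      (ContinuousLinearMapWOT.ofCLM (E (⋃ i, X i)))

/-- Every nonzero effect of an open set has operator norm one. -/
def IsApproximatelySharp (E : Set Ω → H →L[ℂ] H) : Prop :=
  ∀ X : Set Ω, IsOpen X → E X ≠ 0 → ‖E X‖ = 1

end Observables

/-! ### Ladder operators and the exponential series of `z a* - conj z a`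

The finite linear combinations of number states are modelled by `ℕ →₀ ℂ`. -/

/-- The raising operator `a*`, with `a* |n⟩ = √(n+1) |n+1⟩`, on finite combinations. -/
noncomputable def raising : (ℕ →₀ ℂ) →ₗ[ℂ] (ℕ →₀ ℂ) :=
  Finsupp.linearCombination ℂ fun n : ℕ => Finsupp.single (n + 1) ((√((n : ℝ) + 1) : ℝ) : ℂ)

/-- The lowering operator `a`, with `a |n⟩ = √n |n-1⟩` (and `a |0⟩ = 0`), on finite
combinations. -/
noncomputable def lowering : (ℕ →₀ ℂ) →ₗ[ℂ] (ℕ →₀ ℂ) :=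
  Finsupp.linearCombination ℂ fun n : ℕ => Finsupp.single (n - 1) ((√(n : ℝ) : ℝ) : ℂ)

/-- The skew-symmetric operator `z a* - conj z a` on finite combinations of number states. -/
noncomputable def shiftGen (z : ℂ) : (ℕ →₀ ℂ) →ₗ[ℂ] (ℕ →₀ ℂ) :=
  z • raising - (starRingEnd ℂ z) • lowering

lemma shiftGen_single (z : ℂ) (n : ℕ) :
    shiftGen z (Finsupp.single n 1) =
      (z * ((√((n : ℝ) + 1) : ℝ) : ℂ)) • Finsupp.single (n + 1) (1 : ℂ)
        - (starRingEnd ℂ z * ((√(n : ℝ) : ℝ) : ℂ)) • Finsupp.single (n - 1) (1 : ℂ) := by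
  simp [shiftGen, raising, lowering]

section Shift

variable {H : Type*} [NormedAddCommGroup H] [InnerProductSpace ℂ H]
variable (e : HilbertBasis ℕ ℂ H)

/-- The vector of `H` given by a finite combination of the number states `|n⟩ = e n`. -/
noncomputable def finVec : (ℕ →₀ ℂ) →ₗ[ℂ] H := Finsupp.linearCombination ℂ e

lemma finVec_single (n : ℕ) : finVec e (Finsupp.single n 1) = e n := by simp [finVec]

/-- The `k`-th term `(z a* - conj z a)^k |n⟩ / k!` of the exponential series. -/
noncomputable def shiftTerm (z : ℂ) (n k : ℕ) : H :=
  ((k.factorial : ℂ)⁻¹) • finVec e ((shiftGen z ^ k) (Finsupp.single n 1))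

lemma norm_pow_shiftGen_le (z : ℂ) (k n : ℕ) :
    ‖finVec e ((shiftGen z ^ k) (Finsupp.single n 1))‖
      ≤ (2 * ‖z‖) ^ k * √((n + 1).ascFactorial k : ℝ) := by
  induction k generalizing n with
  | zero => simp [finVec, e.orthonormal.1 n]
  | succ k ih =>
    rw [pow_succ, Module.End.mul_apply, shiftGen_single, map_sub, map_smul, map_smul, map_sub,
      map_smul, map_smul]
    refine (norm_sub_le _ _).trans ?_
    rw [norm_smul, norm_smul, norm_mul, norm_mul, RCLike.norm_conj, Complex.norm_real,
      Complex.norm_real, Real.norm_of_nonneg (Real.sqrt_nonneg _),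
      Real.norm_of_nonneg (Real.sqrt_nonneg _)]
    have h1 : √((n : ℝ) + 1) * √((n + 1 + 1).ascFactorial k : ℝ)
        = √((n + 1).ascFactorial (k + 1) : ℝ) := by
      rw [← Real.sqrt_mul (by positivity)]
      congr 1
      have h2 : (n + 1) * (n + 1 + 1).ascFactorial k = (n + 1).ascFactorial (k + 1) := by
        rw [Nat.succ_ascFactorial, Nat.ascFactorial_succ]
      exact_mod_cast h2
    have h3 : √(n : ℝ) * √((n - 1 + 1).ascFactorial k : ℝ)
        ≤ √((n + 1).ascFactorial (k + 1) : ℝ) := by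
      rw [← h1]
      gcongr
      · linarith
      · omega
    calc _ ≤ ‖z‖ * √((n : ℝ) + 1) * ((2 * ‖z‖) ^ k * √((n + 1 + 1).ascFactorial k : ℝ))
          + ‖z‖ * √(n : ℝ) * ((2 * ‖z‖) ^ k * √((n - 1 + 1).ascFactorial k : ℝ)) := by
            gcongr
            · exact ih _
            · exact ih _
      _ = ‖z‖ * (2 * ‖z‖) ^ k * (√((n : ℝ) + 1) * √((n + 1 + 1).ascFactorial k : ℝ))
          + ‖z‖ * (2 * ‖z‖) ^ k * (√(n : ℝ) * √((n - 1 + 1).ascFactorial k : ℝ)) := by ring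
      _ ≤ ‖z‖ * (2 * ‖z‖) ^ k * √((n + 1).ascFactorial (k + 1) : ℝ)
          + ‖z‖ * (2 * ‖z‖) ^ k * √((n + 1).ascFactorial (k + 1) : ℝ) := by
            rw [h1]; gcongr
      _ = _ := by ring

lemma summable_norm_shiftTerm (z : ℂ) (n : ℕ) : Summable fun k => ‖shiftTerm e z n k‖ := by
  have hs : Summable fun k : ℕ =>
      ((2 ^ n : ℝ) * ((16 * ‖z‖ ^ 2) ^ k / k.factorial) + (1 / 2) ^ k) / 2 :=
    (((Real.summable_pow_div_factorial _).mul_left _).add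
      summable_geometric_two).div_const 2
  refine hs.of_nonneg_of_le (fun k => norm_nonneg _) fun k => ?_
  have hy : ‖shiftTerm e z n k‖
      ≤ (2 * ‖z‖) ^ k * √((n + 1).ascFactorial k : ℝ) / k.factorial := by
    rw [shiftTerm, norm_smul, norm_inv, Complex.norm_natCast, inv_mul_eq_div]
    gcongr
    exact norm_pow_shiftGen_le e z k n
  have hk : (0 : ℝ) < k.factorial := by exact_mod_cast k.factorial_pos
  set y := ‖shiftTerm e z n k‖ with hydef
  have hy0 : 0 ≤ y := norm_nonneg _
  have hA : ((n + 1).ascFactorial k : ℝ) ≤ k.factorial * (2 ^ n * 2 ^ k) := by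
    rw [← pow_add]
    have := Nat.mul_le_mul_left k.factorial (Nat.choose_le_two_pow (n + k) k)
    rw [← Nat.ascFactorial_eq_factorial_mul_choose] at this
    exact_mod_cast this
  have hsq : y ^ 2 ≤ (2 ^ n : ℝ) * ((8 * ‖z‖ ^ 2) ^ k / k.factorial) := by
    calc y ^ 2 ≤ ((2 * ‖z‖) ^ k * √((n + 1).ascFactorial k : ℝ) / k.factorial) ^ 2 := by gcongr
      _ = ((2 * ‖z‖) ^ k) ^ 2 * ((n + 1).ascFactorial k : ℝ) / (k.factorial : ℝ) ^ 2 := by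
          rw [div_pow, mul_pow, Real.sq_sqrt (by positivity)]
      _ ≤ ((2 * ‖z‖) ^ k) ^ 2 * (k.factorial * (2 ^ n * 2 ^ k)) / (k.factorial : ℝ) ^ 2 := by
          gcongr
      _ = (2 ^ n : ℝ) * ((8 * ‖z‖ ^ 2) ^ k / k.factorial) := by
          have : (8 * ‖z‖ ^ 2) ^ k = ((2 * ‖z‖) ^ k) ^ 2 * 2 ^ k := by
            rw [← pow_mul, mul_comm k 2, pow_mul, ← mul_pow]; ring
          rw [this]; field_simp
  have h2 : (16 * ‖z‖ ^ 2) ^ k = 2 ^ k * (8 * ‖z‖ ^ 2) ^ k := by rw [← mul_pow]; ring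
  have h3 : 2 * y ≤ 2 ^ k * y ^ 2 + (1 / 2) ^ k := by
    have hp : (0 : ℝ) < 2 ^ k := by positivity
    have : (2 : ℝ) ^ k * y ^ 2 + (1 / 2) ^ k - 2 * y = (2 ^ k * y - 1) ^ 2 / 2 ^ k := by
      rw [one_div, inv_pow]; field_simp; ring
    have : 0 ≤ (2 ^ k * y - 1) ^ 2 / (2 : ℝ) ^ k := by positivity
    linarith
  have h4 : (2 : ℝ) ^ k * y ^ 2 ≤ 2 ^ n * ((16 * ‖z‖ ^ 2) ^ k / k.factorial) := by
    rw [h2]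
    calc (2 : ℝ) ^ k * y ^ 2 ≤ 2 ^ k * ((2 ^ n : ℝ) * ((8 * ‖z‖ ^ 2) ^ k / k.factorial)) := by
          gcongr
      _ = _ := by ring
  linarith

lemma inner_shiftGen (z : ℂ) (x y : ℕ →₀ ℂ) :
    ⟪finVec e (shiftGen z x), finVec e y⟫_ℂ = -⟪finVec e x, finVec e (shiftGen z y)⟫_ℂ := by
  induction x using Finsupp.induction_linear with
  | zero => simp
  | add x x' hx hx' => simp only [map_add, inner_add_left, hx, hx']; ring
  | single m c =>
  induction y using Finsupp.induction_linear with
  | zero => simp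
  | add y y' hy hy' => simp only [map_add, inner_add_right, hy, hy']; ring
  | single n d =>
    rw [← mul_one c, ← mul_one d, ← smul_eq_mul, ← smul_eq_mul, ← Finsupp.smul_single,
      ← Finsupp.smul_single]
    simp only [map_smul, inner_smul_left, inner_smul_right, shiftGen_single, map_sub, finVec_single,
      inner_sub_left, inner_sub_right, orthonormal_iff_ite.1 e.orthonormal, map_mul,
      Complex.conj_conj, Complex.conj_ofReal]
    rcases lt_trichotomy m n with h | h | h
    · rw [if_neg (show ¬ m - 1 = n by omega), if_neg (show ¬ m = n + 1 by omega)]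
      by_cases h' : n = m + 1
      · subst h'; simp; try ring_nf; simp
      · rw [if_neg (show ¬ m + 1 = n by omega), if_neg (show ¬ m = n - 1 by omega)]; simp
    · subst h
      rcases m with _ | m
      · simp
      · simp
    · rw [if_neg (show ¬ m + 1 = n by omega), if_neg (show ¬ m = n - 1 by omega)]
      by_cases h' : m = n + 1
      · subst h'; simp; try ring_nf; simp
      · rw [if_neg (show ¬ m - 1 = n by omega), if_neg (show ¬ m = n + 1 by omega)]; simp

lemma inner_shiftGen_pow (z : ℂ) (k : ℕ) (x y : ℕ →₀ ℂ) :
    ⟪finVec e ((shiftGen z ^ k) x), finVec e y⟫_ℂ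
      = (-1) ^ k * ⟪finVec e x, finVec e ((shiftGen z ^ k) y)⟫_ℂ := by
  induction k generalizing x y with
  | zero => simp
  | succ k ih =>
    rw [pow_succ, Module.End.mul_apply, ih, inner_shiftGen, ← Module.End.mul_apply, ← pow_succ',
      ← pow_succ]
    ring

lemma orthonormal_phase (t : Circle) : Orthonormal ℂ fun n : ℕ => ((t : ℂ) ^ n) • e n := by
  rw [orthonormal_iff_ite]
  intro i j
  rw [inner_smul_left, inner_smul_right, orthonormal_iff_ite.1 e.orthonormal]
  split_ifs with h
  · subst h
    rw [mul_one, Complex.conj_mul', norm_pow, Circle.norm_coe]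
    simp
  · simp

variable [CompleteSpace H]

/-- `D(z) |n⟩ = ∑ₖ (z a* - conj z a)^k |n⟩ / k!`. -/
noncomputable def shiftVec (z : ℂ) (n : ℕ) : H := ∑' k, shiftTerm e z n k

lemma hasSum_shiftTerm (z : ℂ) (n : ℕ) : HasSum (shiftTerm e z n) (shiftVec e z n) :=
  (summable_norm_shiftTerm e z n).of_norm.hasSum

lemma inner_shiftVec (z : ℂ) (m n : ℕ) :
    ⟪shiftVec e z m, shiftVec e z n⟫_ℂ = if m = n then 1 else 0 := by
  let f : ℕ × ℕ → ℂ := fun p => ⟪shiftTerm e z m p.1, shiftTerm e z n p.2⟫_ℂ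
  have hf : Summable f := by
    refine Summable.of_norm_bounded ((summable_norm_shiftTerm e z m).mul_of_nonneg
      (summable_norm_shiftTerm e z n) (fun _ => norm_nonneg _) fun _ => norm_nonneg _) fun p => ?_
    exact norm_inner_le_norm _ _
  have h1 : ⟪shiftVec e z m, shiftVec e z n⟫_ℂ = ∑' p, f p := by
    rw [hf.tsum_prod]
    have hr : ∀ x : H, HasSum (fun k => ⟪x, shiftTerm e z n k⟫_ℂ) ⟪x, shiftVec e z n⟫_ℂ :=
      fun x => (hasSum_shiftTerm e z n).mapL (innerSL ℂ x)
    have hl : HasSum (fun j => ⟪shiftTerm e z m j, shiftVec e z n⟫_ℂ)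
        ⟪shiftVec e z m, shiftVec e z n⟫_ℂ :=
      (hasSum_shiftTerm e z m).map ((innerSLFlip ℂ (shiftVec e z n)))
        (innerSLFlip ℂ (shiftVec e z n)).continuous
    rw [← hl.tsum_eq]
    exact tsum_congr fun j => (hr _).tsum_eq.symm
  have hf' : Summable fun q => f (Finset.HasAntidiagonal.sigmaAntidiagonalEquivProd q) :=
    (Finset.HasAntidiagonal.sigmaAntidiagonalEquivProd.summable_iff).2 hf
  rw [h1, ← Finset.HasAntidiagonal.sigmaAntidiagonalEquivProd.tsum_eq f,
    Summable.tsum_sigma' (fun _ => (hasSum_fintype _).summable) hf']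
  have h2 : ∀ N : ℕ, (∑' p : Finset.HasAntidiagonal.antidiagonal N,
      f (Finset.HasAntidiagonal.sigmaAntidiagonalEquivProd ⟨N, p⟩))
        = if N = 0 then ⟪e m, e n⟫_ℂ else 0 := by
    intro N
    rw [tsum_fintype]
    have h3 : ∀ p ∈ Finset.HasAntidiagonal.antidiagonal N, f p = ((N.factorial : ℂ)⁻¹ *
        ⟪e m, finVec e ((shiftGen z ^ N) (Finsupp.single n 1))⟫_ℂ)
          * ((-1) ^ p.1 * (N.choose p.1 : ℂ)) := by
      rintro ⟨i, j⟩ hp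
      rw [Finset.HasAntidiagonal.mem_antidiagonal] at hp
      subst hp
      simp only [f, shiftTerm, inner_smul_left, inner_smul_right, inner_shiftGen_pow, map_inv₀,
        map_natCast]
      rw [← Module.End.mul_apply, ← pow_add, finVec_single]
      have hc : ((i + j).choose i : ℂ) * i.factorial * j.factorial = (i + j).factorial := by
        have := Nat.choose_mul_factorial_mul_factorial (Nat.le_add_right i j)
        rw [Nat.add_sub_cancel_left] at this
        exact_mod_cast this
      have hi : (i.factorial : ℂ) ≠ 0 := by exact_mod_cast i.factorial_ne_zero
      have hj : (j.factorial : ℂ) ≠ 0 := by exact_mod_cast j.factorial_ne_zero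
      rw [← hc]
      have hch : ((i + j).choose i : ℂ) ≠ 0 := by
        exact_mod_cast (Nat.choose_pos (Nat.le_add_right i j)).ne'
      field_simp
    have h4 : ∑ p : Finset.HasAntidiagonal.antidiagonal N,
        f (Finset.HasAntidiagonal.sigmaAntidiagonalEquivProd ⟨N, p⟩)
          = ∑ p ∈ Finset.HasAntidiagonal.antidiagonal N, f p := Finset.sum_coe_sort (Finset.HasAntidiagonal.antidiagonal N) f
    rw [h4, Finset.sum_congr rfl h3, ← Finset.mul_sum,
      Finset.Nat.sum_antidiagonal_eq_sum_range_succ_mk]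
    have h5 : ∑ k ∈ Finset.range N.succ, ((-1) ^ k * (N.choose k : ℂ)) = if N = 0 then 1 else 0 := by
      exact_mod_cast congrArg (Int.cast : ℤ → ℂ) (Int.alternating_sum_range_choose (n := N))
    rw [h5]
    split_ifs with h
    · subst h; simp [finVec_single]
    · simp
  rw [tsum_congr h2, tsum_ite_eq]
  exact orthonormal_iff_ite.1 e.orthonormal m n

lemma orthonormal_shiftVec (z : ℂ) : Orthonormal ℂ (shiftVec e z) :=
  orthonormal_iff_ite.2 (inner_shiftVec e z)

/-- The bounded operator mapping the Hilbert basis `e` to a given orthonormal sequence `v`. -/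
noncomputable def mapBasis (v : ℕ → H) (hv : Orthonormal ℂ v) : H →L[ℂ] H :=
  (hv.orthogonalFamily.linearIsometry.comp e.repr.toLinearIsometry).toContinuousLinearMap

lemma mapBasis_apply (v : ℕ → H) (hv : Orthonormal ℂ v) (n : ℕ) : mapBasis e v hv (e n) = v n := by
  change hv.orthogonalFamily.linearIsometry (e.repr (e n)) = v n
  classical
  rw [e.repr_self, OrthogonalFamily.linearIsometry_apply_single]
  simp

/-- The shift operator `D(z) = exp(z a* - conj z a)`: the bounded operator given on each number
state by the (absolutely convergent) exponential series. -/
noncomputable def shiftOp (z : ℂ) : H →L[ℂ] H := mapBasis e (shiftVec e z) (orthonormal_shiftVec e z)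

lemma hasSum_shiftOp (z : ℂ) (n : ℕ) :
    HasSum (fun k : ℕ => ((k.factorial : ℂ)⁻¹) • finVec e ((shiftGen z ^ k) (Finsupp.single n 1)))
      (shiftOp e z (e n)) := by
  rw [shiftOp, mapBasis_apply]
  exact hasSum_shiftTerm e z n

lemma inner_mapBasis (v : ℕ → H) (hv : Orthonormal ℂ v) (x y : H) :
    ⟪mapBasis e v hv x, mapBasis e v hv y⟫_ℂ = ⟪x, y⟫_ℂ :=
  (hv.orthogonalFamily.linearIsometry.comp e.repr.toLinearIsometry).inner_map_map x y

lemma adjoint_shiftOp (z : ℂ) : (shiftOp e z).adjoint = shiftOp e (-z) := by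
  have hneg : shiftGen (-z) = (-1 : ℂ) • shiftGen z := by
    simp only [shiftGen, map_neg]; module
  have key : ∀ m n, ⟪shiftOp e z (e m), e n⟫_ℂ = ⟪e m, shiftOp e (-z) (e n)⟫_ℂ := by
    intro m n
    have hl : HasSum _ ⟪shiftOp e z (e m), e n⟫_ℂ :=
      (hasSum_shiftOp e z m).map (innerSLFlip ℂ (e n)) (innerSLFlip ℂ (e n)).continuous
    have hr : HasSum _ ⟪e m, shiftOp e (-z) (e n)⟫_ℂ :=
      (hasSum_shiftOp e (-z) n).mapL (innerSL ℂ (e m))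
    refine hl.unique ?_
    convert hr using 2 with k
    simp only [Function.comp, innerSLFlip_apply_apply, innerSL_apply_apply, inner_smul_left,
      inner_smul_right, map_inv₀, map_natCast]
    rw [← finVec_single e n, inner_shiftGen_pow, hneg, smul_pow, LinearMap.smul_apply, map_smul,
      inner_smul_right, finVec_single]
  refine ContinuousLinearMap.ext fun x => ?_
  have hx := e.hasSum_repr x
  refine (hx.mapL (shiftOp e z).adjoint).unique ?_
  convert hx.mapL (shiftOp e (-z)) using 2 with n
  rw [map_smul, map_smul]
  congr 1
  refine e.repr.injective (lp.ext (funext fun m => ?_))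
  rw [e.repr_apply_apply, e.repr_apply_apply, ContinuousLinearMap.adjoint_inner_right, key]

/-- The shift operators are unitary. -/
lemma shiftOp_mem_unitary (z : ℂ) : shiftOp e z ∈ unitary (H →L[ℂ] H) := by
  have h : ∀ w, (shiftOp e w).adjoint ∘L shiftOp e w = 1 := fun w =>
    ContinuousLinearMap.ext fun x => ext_inner_left ℂ fun y => by
      rw [ContinuousLinearMap.comp_apply, ContinuousLinearMap.adjoint_inner_right]
      exact inner_mapBasis e _ _ y x
  rw [Unitary.mem_iff]
  refine ⟨h z, ?_⟩
  have := h (-z)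
  rw [adjoint_shiftOp, neg_neg] at this
  rw [ContinuousLinearMap.star_eq_adjoint, adjoint_shiftOp]
  exact this

/-- The number representation of the torus: `U(t) |n⟩ = t^n |n⟩`. -/
noncomputable def numberRep (t : Circle) : H →L[ℂ] H :=
  mapBasis e (fun n : ℕ => ((t : ℂ) ^ n) • e n) (orthonormal_phase e t)

lemma numberRep_apply (t : Circle) (n : ℕ) : numberRep e t (e n) = ((t : ℂ) ^ n) • e n :=
  mapBasis_apply e _ _ n

/-! ### Phase observables -/

/-- An observable on the torus with `U(t) E(X) U(t)* = E(tX)`. -/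
structure IsPhaseObservable (E : Set Circle → H →L[ℂ] H) : Prop where
  isObservable : IsObservable E
  covariant : ∀ (t : Circle) (X : Set Circle), MeasurableSet[borel Circle] X →
    numberRep e t ∘L E X ∘L (numberRep e t).adjoint = E ((fun s => t * s) '' X)

/-- The set `arg X ⊆ [0, 2π)` of arguments of the points of `X`. -/
def argSet (X : Set Circle) : Set ℝ := {θ | θ ∈ Set.Ico 0 (2 * Real.pi) ∧ Circle.exp θ ∈ X}

/-- `c` is a phase matrix of `E`: it is positive semidefinite with unit diagonal and
`⟨m|E(X)|n⟩ = c m n * ∫_{arg X} exp(i(m-n)θ) dθ/(2π)`. -/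
structure IsPhaseMatrix (E : Set Circle → H →L[ℂ] H) (c : Matrix ℕ ℕ ℂ) : Prop where
  posSemidef : c.PosSemidef
  diag : ∀ n, c n n = 1
  inner_eq : ∀ (m n : ℕ) (X : Set Circle), MeasurableSet[borel Circle] X →
    ⟪e m, E X (e n)⟫_ℂ = c m n * ((2 * Real.pi : ℝ) : ℂ)⁻¹ *
      ∫ θ in argSet X, Complex.exp (Complex.I * ((m : ℂ) - (n : ℂ)) * (θ : ℂ))

/-- A diagonal state `T = ∑ₙ λₙ |n⟩⟨n|` with `λₙ ≥ 0` and `∑ₙ λₙ = 1`. -/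
def IsDiagonalState (T : H →L[ℂ] H) : Prop :=
  ∃ l : ℕ → ℝ, (∀ n, 0 ≤ l n) ∧ HasSum l 1 ∧
    HasSum (fun n => (l n : ℂ) • InnerProductSpace.rankOne ℂ (e n) (e n)) T

/-- The function `⟨u| D(re^{iθ}) T D(re^{iθ})* |v⟩ r` of `p = (θ, r)`. -/
noncomputable def stateDensity (T : H →L[ℂ] H) (u v : H) (p : ℝ × ℝ) : ℂ :=
  ⟪u, (shiftOp e ((p.2 : ℂ) * (Circle.exp p.1 : ℂ)) ∘L T ∘L
    (shiftOp e ((p.2 : ℂ) * (Circle.exp p.1 : ℂ))).adjoint) v⟫_ℂ * (p.2 : ℂ)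

/-- `A` is the weak integral
`(1/π) ∫_{arg X} ∫_0^∞ D(re^{iθ}) T D(re^{iθ})* r dr dθ`. -/
def IsStateIntegral (T : H →L[ℂ] H) (X : Set Circle) (A : H →L[ℂ] H) : Prop :=
  ∀ u v : H,
    MeasureTheory.IntegrableOn (stateDensity e T u v) (argSet X ×ˢ Set.Ioi 0) ∧
    ⟪u, A v⟫_ℂ = ((Real.pi : ℝ) : ℂ)⁻¹ *
      ∫ θ in argSet X, ∫ r in Set.Ioi (0 : ℝ), stateDensity e T u v (θ, r)

lemma IsStateIntegral.unique {T : H →L[ℂ] H} {X : Set Circle} {A B : H →L[ℂ] H}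
    (hA : IsStateIntegral e T X A) (hB : IsStateIntegral e T X B) : A = B :=
  ContinuousLinearMap.ext fun v => ext_inner_left ℂ fun u => by rw [(hA u v).2, (hB u v).2]

open Classical in
/-- The observable `E_T` generated by `T`: `E_T(X)` is the weak integral
`(1/π) ∫_{arg X} ∫_0^∞ D(re^{iθ}) T D(re^{iθ})* r dr dθ` (and `0` if that does not exist). -/
noncomputable def stateGenerated (T : H →L[ℂ] H) (X : Set Circle) : H →L[ℂ] H :=
  if h : ∃ A, IsStateIntegral e T X A then h.choose else 0

end Shift

end PhaseObs

/-! Up to a phase common to all `s` and `m`, `⟨m|D(re^{iθ})|s⟩ = e^{i(m-s)θ} f_{s,m}(r)`, where the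
real function `f_{s,m}` (`radial`) is a polynomial times `exp(-r²/2)`. The phase cancels in `D T
D*`, and in `⟨m|D T D*|n⟩` the angular part is `e^{i(m-n)θ}`, independent of `s`. Integrating over
`r` shows that `E_T` has the phase matrix `c_{m,n} = ∑ₛ λₛ ⟨f_{s,m}, f_{s,n}⟩`, with inner products
(`overlap`) in `L²((0,∞), 2r dr)`: a convex combination of Gram matrices
(`inner_stateGenerated_basis`, `posSemidef_overlapMatrix`). Covariance and normalization are read
off from these matrix elements.

The analytic core is `overlap_succ`: integration by parts gives `√(s+1) (overlap (s+1) m n - overlap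
s m n) = (m-n) ∫ f_{s,m} f_{s+1,n} dr`. For `m = n` the overlap does not depend on `s`, so it is `1`
as for `s = 0`. For `n = m+k` the right side tends to `0`, because the mass of `f_{s,m}` escapes to
infinity in `r` as `m` grows while the integral lacks the weight `r`. The limit `1` is therefore
inherited from `s = 0`, where the overlap is a quotient of Gamma values controlled by log-convexity
(`tendsto_overlap`). Dominated convergence in `s` gives `c_{m,m+k} → 1`. Phase matrices are unique
because each character has a nonzero integral over some Borel set.

Existence of the weak integral rests on square integrability of the matrix elements, from the
orthogonality of the functions `e^{i(m-s)θ} f_{s,m}(r)` and Fatou's lemma, followed by the Riesz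
representation of a bounded sesquilinear form.

For sharpness, take `t₀` in the open set `X` and the vectors `∑ⱼ (n choose j) t₀^j |N+j⟩`. As `N →
∞` the entries of the phase matrix tend to `1`, so the distribution of the phase tends to the
density `|1 + t₀ conj t|^{2n}/2π`. It concentrates at `t₀` as `n → ∞`: off `X` it is at most
`q^n/2π` with `q < 4`, whereas the squared norm is at least `4^n/(n+1)`. -/

namespace PhaseObs

/-! ### Radial parts of the matrix elements of the shift operators -/

section Radial

open MeasureTheory Filter Topology Set

/-- The polynomial part of the radial matrix element `⟨m|D(r)|s⟩`. -/
noncomputable def radialPoly : ℕ → ℕ → ℝ → ℝ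
  | 0, m, r => r ^ m / √(m.factorial : ℝ)
  | s + 1, m, r => (√(m : ℝ) * radialPoly s (m - 1) r - r * radialPoly s m r) / √((s : ℝ) + 1)

lemma radialPoly_zero (m : ℕ) (r : ℝ) : radialPoly 0 m r = r ^ m / √(m.factorial : ℝ) := rfl

/-- The radial form of `D(r) a* = (a* - r) D(r)`. At `m = 0` the truncated index `m - 1` is harmless
because its coefficient is `√0`. -/
lemma sqrt_mul_radialPoly_succ (s m : ℕ) (r : ℝ) :
    √((s : ℝ) + 1) * radialPoly (s + 1) m r
      = √(m : ℝ) * radialPoly s (m - 1) r - r * radialPoly s m r := by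
  have : √((s : ℝ) + 1) ≠ 0 := by positivity
  rw [radialPoly]
  field_simp

/-- The same recursion moved down by one and multiplied by `√s`, so that it also covers `s = 0`,
where both sides vanish. -/
lemma sqrt_mul_radialPoly_pred (s m : ℕ) (r : ℝ) :
    √(s : ℝ) * (√(m : ℝ) * radialPoly (s - 1) (m - 1) r - r * radialPoly (s - 1) m r)
      = s * radialPoly s m r := by
  rcases s with _ | s
  · simp
  · have := sqrt_mul_radialPoly_succ s m r
    have h2 : √((s : ℝ) + 1) * √((s : ℝ) + 1) = (s : ℝ) + 1 := Real.mul_self_sqrt (by positivity)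
    push_cast
    linear_combination -√((s : ℝ) + 1) * this + radialPoly (s + 1) m r * h2

lemma sqrt_mul_radialPoly_zero_succ (m : ℕ) (r : ℝ) :
    √((m : ℝ) + 1) * radialPoly 0 (m + 1) r = r * radialPoly 0 m r := by
  have h : √((m + 1).factorial : ℝ) = √((m : ℝ) + 1) * √(m.factorial : ℝ) := by
    rw [Nat.factorial_succ]; push_cast; rw [Real.sqrt_mul (by positivity)]
  have h1 : √((m : ℝ) + 1) ≠ 0 := by positivity
  have h2 : √(m.factorial : ℝ) ≠ 0 := by positivity
  rw [radialPoly_zero, radialPoly_zero, h]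
  field_simp
  ring

/-- The lowering relation and the eigenvalue equation of the angular momentum. -/
lemma radialPoly_relations (s : ℕ) :
    (∀ (m : ℕ) (r : ℝ), √((m : ℝ) + 1) * radialPoly s (m + 1) r
      = √(s : ℝ) * radialPoly (s - 1) m r + r * radialPoly s m r) ∧
    ∀ (m : ℕ) (r : ℝ), r * (√(m : ℝ) * radialPoly s (m - 1) r + √(s : ℝ) * radialPoly (s - 1) m r)
      = ((m : ℝ) - s) * radialPoly s m r := by
  induction s with
  | zero =>
    refine ⟨fun m r => by simpa using sqrt_mul_radialPoly_zero_succ m r, fun m r => ?_⟩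
    rcases m with _ | m
    · simp
    · have h := sqrt_mul_radialPoly_zero_succ m r
      have h2 : √((m : ℝ) + 1) * √((m : ℝ) + 1) = (m : ℝ) + 1 := Real.mul_self_sqrt (by positivity)
      push_cast
      simp only [Real.sqrt_zero, zero_mul, add_zero, sub_zero]
      linear_combination -√((m : ℝ) + 1) * h + radialPoly 0 (m + 1) r * h2
  | succ s ih =>
    obtain ⟨h1, h2⟩ := ih
    have hs : √((s : ℝ) + 1) ≠ 0 := by positivity
    have hs2 : √((s : ℝ) + 1) * √((s : ℝ) + 1) = (s : ℝ) + 1 := Real.mul_self_sqrt (by positivity)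
    -- The two relations have to be proved together: each of them at `s + 1` uses both of them at
    -- `s`.
    constructor
    · intro m r
      have hm2 : √((m : ℝ) + 1) * √((m : ℝ) + 1) = (m : ℝ) + 1 := Real.mul_self_sqrt (by positivity)
      have a1 := sqrt_mul_radialPoly_succ s (m + 1) r
      have a2 := sqrt_mul_radialPoly_succ s m r
      have a3 := h1 m r
      have a4 := h2 m r
      apply mul_left_cancel₀ hs
      push_cast at *
      linear_combination √((m : ℝ) + 1) * a1 + radialPoly s m r * hm2 - r * a3 - r * a2
        - radialPoly s m r * hs2 - a4
    · intro m r
      apply mul_left_cancel₀ hs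
      have a2 := sqrt_mul_radialPoly_succ s m r
      rcases m with _ | m
      · have a4 := h2 0 r
        push_cast at *
        simp only [Real.sqrt_zero, zero_mul, zero_add, zero_sub] at *
        linear_combination r * radialPoly s 0 r * hs2 + ((s : ℝ) + 1) * a2
      have hm2 : √((m : ℝ) + 1) * √((m : ℝ) + 1) = (m : ℝ) + 1 := Real.mul_self_sqrt (by positivity)
      have a1 := sqrt_mul_radialPoly_succ s m r
      have a3 := h1 m r
      have a4 := h2 m r
      push_cast at *
      linear_combination √((m : ℝ) + 1) * r * a1 + r * radialPoly s (m + 1) r * hs2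
        - ((m : ℝ) - s) * a2 + √((m : ℝ) + 1) * a4 + r * √((m : ℝ) + 1) * a3
        - r * radialPoly s (m + 1) r * hm2

lemma radialPoly_angular (s m : ℕ) (r : ℝ) :
    r * (√(m : ℝ) * radialPoly s (m - 1) r + √(s : ℝ) * radialPoly (s - 1) m r)
      = ((m : ℝ) - s) * radialPoly s m r :=
  (radialPoly_relations s).2 m r

/-- Corresponds to `d/dr D(r) = (a* - a) D(r)`: the lowering relation removes the index `m + 1`, and
the resulting term `-r` is the derivative of the exponent `-r²/2`. The proof avoids operators and
differentiates the recursion in `s`. -/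
lemma hasDerivAt_radialPoly (s m : ℕ) (r : ℝ) :
    HasDerivAt (radialPoly s m)
      (√(m : ℝ) * radialPoly s (m - 1) r - √(s : ℝ) * radialPoly (s - 1) m r) r := by
  induction s generalizing m with
  | zero =>
    have h : HasDerivAt (fun r : ℝ => r ^ m / √(m.factorial : ℝ))
        ((m : ℝ) * r ^ (m - 1) / √(m.factorial : ℝ)) r := (hasDerivAt_pow m r).div_const _
    refine h.congr_deriv ?_
    rcases m with _ | m
    · simp
    · have hm2 : √((m : ℝ) + 1) * √((m : ℝ) + 1) = (m : ℝ) + 1 := Real.mul_self_sqrt (by positivity)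
      have h : √((m + 1).factorial : ℝ) = √((m : ℝ) + 1) * √(m.factorial : ℝ) := by
        rw [Nat.factorial_succ]; push_cast; rw [Real.sqrt_mul (by positivity)]
      have h1 : √((m : ℝ) + 1) ≠ 0 := by positivity
      have h2 : √(m.factorial : ℝ) ≠ 0 := by positivity
      rw [h, Nat.add_sub_cancel, radialPoly_zero]
      push_cast
      field_simp
      simp
      linear_combination -r ^ m * hm2
  | succ s ih =>
    have h : HasDerivAt (fun r : ℝ => (√(m : ℝ) * radialPoly s (m - 1) r - r * radialPoly s m r)
        / √((s : ℝ) + 1)) _ r :=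
      (((ih (m - 1)).const_mul (√(m : ℝ))).sub ((hasDerivAt_id r).mul (ih m))).div_const _
    refine (h.congr_deriv ?_)
    have hs : √((s : ℝ) + 1) ≠ 0 := by positivity
    have hs2 : √((s : ℝ) + 1) * √((s : ℝ) + 1) = (s : ℝ) + 1 := Real.mul_self_sqrt (by positivity)
    rw [div_eq_iff hs]
    have a1 := sqrt_mul_radialPoly_succ s (m - 1) r
    have a2 := sqrt_mul_radialPoly_pred s m r
    push_cast
    simp only [id]
    linear_combination -√(m : ℝ) * a1 - a2 + radialPoly s m r * hs2

lemma exists_polynomial_radialPoly (s m : ℕ) :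
    ∃ P : Polynomial ℝ, ∀ r, radialPoly s m r = P.eval r := by
  induction s generalizing m with
  | zero =>
    exact ⟨Polynomial.C (1 / √(m.factorial : ℝ)) * Polynomial.X ^ m, fun r => by
      simp [radialPoly_zero]; ring⟩
  | succ s ih =>
    obtain ⟨P, hP⟩ := ih (m - 1)
    obtain ⟨Q, hQ⟩ := ih m
    exact ⟨Polynomial.C (1 / √((s : ℝ) + 1)) *
      (Polynomial.C (√(m : ℝ)) * P - Polynomial.X * Q), fun r => by
        simp [radialPoly, hP, hQ]; ring⟩

lemma continuous_radialPoly (s m : ℕ) : Continuous (radialPoly s m) := by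
  obtain ⟨P, hP⟩ := exists_polynomial_radialPoly s m
  rw [funext hP]
  exact P.continuous

/-! ### Integrability and decay of polynomials against the Gaussian. -/

lemma integrable_eval_mul_exp_neg_sq (P : Polynomial ℝ) :
    Integrable fun r : ℝ => P.eval r * Real.exp (-r ^ 2) := by
  induction P using Polynomial.induction_on' with
  | add P Q hP hQ =>
    simp only [Polynomial.eval_add, add_mul]
    exact hP.add hQ
  | monomial n a =>
    have h := integrable_rpow_mul_exp_neg_mul_sq (b := 1) one_pos (s := (n : ℝ))
      (by linarith [n.cast_nonneg (α := ℝ)])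
    simpa [mul_assoc] using h.const_mul a

lemma tendsto_eval_mul_exp_neg_sq (P : Polynomial ℝ) :
    Tendsto (fun r : ℝ => P.eval r * Real.exp (-r ^ 2)) atTop (𝓝 0) := by
  have h := (P.tendsto_div_exp_atTop).norm
  rw [norm_zero] at h
  refine squeeze_zero_norm' ?_ h
  -- For `r ≥ 1` one has `r ≤ r²`, so comparison with `exp(-r)` suffices.
  filter_upwards [eventually_ge_atTop 1] with r hr
  rw [norm_mul, norm_div, Real.norm_of_nonneg (Real.exp_pos _).le,
    Real.norm_of_nonneg (Real.exp_pos _).le, div_eq_mul_inv, ← Real.exp_neg]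
  gcongr
  nlinarith

/-- The radial matrix element `⟨m|D(r)|s⟩`. -/
noncomputable def radial (s m : ℕ) (r : ℝ) : ℝ := Real.exp (-r ^ 2 / 2) * radialPoly s m r

lemma continuous_radial (s m : ℕ) : Continuous (radial s m) := by
  have := continuous_radialPoly s m
  unfold radial
  fun_prop

lemma exp_half_mul_exp_half (r : ℝ) :
    Real.exp (-r ^ 2 / 2) * Real.exp (-r ^ 2 / 2) = Real.exp (-r ^ 2) := by
  rw [← Real.exp_add]; ring_nf

lemma integrable_radial_mul (s m s' m' : ℕ) : Integrable fun r => radial s m r * radial s' m' r := by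
  obtain ⟨P, hP⟩ := exists_polynomial_radialPoly s m
  obtain ⟨Q, hQ⟩ := exists_polynomial_radialPoly s' m'
  convert integrable_eval_mul_exp_neg_sq (P * Q) using 2 with r
  rw [radial, radial, hP, hQ, ← exp_half_mul_exp_half, Polynomial.eval_mul]
  ring

lemma integrable_radial_mul_mul (s m s' m' : ℕ) :
    Integrable fun r => radial s m r * radial s' m' r * r := by
  obtain ⟨P, hP⟩ := exists_polynomial_radialPoly s m
  obtain ⟨Q, hQ⟩ := exists_polynomial_radialPoly s' m'
  convert integrable_eval_mul_exp_neg_sq (P * Q * Polynomial.X) using 2 with r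
  rw [radial, radial, hP, hQ, ← exp_half_mul_exp_half, Polynomial.eval_mul, Polynomial.eval_mul,
    Polynomial.eval_X]
  ring

/-- The overlap of two radial matrix elements in `L²((0,∞), 2r dr)`. -/
noncomputable def overlap (s m n : ℕ) : ℝ := 2 * ∫ r in Ioi (0 : ℝ), radial s m r * radial s n r * r

/-- Integrates over `(0,∞)` the derivative of `r · f_{s,m}(r) · f_{s+1,n}(r)`. The boundary terms
vanish, by the factor `r` at `0` and by Gaussian decay at infinity. -/
lemma overlap_succ (s m n : ℕ) :
    √((s : ℝ) + 1) * (overlap (s + 1) m n - overlap s m n)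
      = ((m : ℝ) - n) * ∫ r in Ioi (0 : ℝ), radial s m r * radial (s + 1) n r := by
  obtain ⟨P, hP⟩ := exists_polynomial_radialPoly s m
  obtain ⟨Q, hQ⟩ := exists_polynomial_radialPoly (s + 1) n
  have hd : ∀ r : ℝ, HasDerivAt
      (fun r => r * (radialPoly s m r * radialPoly (s + 1) n r) * Real.exp (-r ^ 2))
      (√((s : ℝ) + 1) * (2 * (radial (s + 1) m r * radial (s + 1) n r * r)
        - 2 * (radial s m r * radial s n r * r))
        - ((m : ℝ) - n) * (radial s m r * radial (s + 1) n r)) r := by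
    intro r
    have he : HasDerivAt (fun r : ℝ => Real.exp (-r ^ 2)) (Real.exp (-r ^ 2) * (-(2 * r))) r := by
      have := ((hasDerivAt_pow 2 r).neg).exp
      simpa using this
    have h := ((hasDerivAt_id r).mul ((hasDerivAt_radialPoly s m r).mul
      (hasDerivAt_radialPoly (s + 1) n r))).mul he
    refine h.congr_deriv ?_
    -- The angular relations replace `r` times each derivative. They leave the multiples `-(m-s)`
    -- and `n-(s+1)` of the product, which with the `1` from differentiating `r` add up to `-(m-n)`;
    -- `a1` turns the rest into the two overlap integrands.
    have a1 := sqrt_mul_radialPoly_succ s m r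
    have a2 := sqrt_mul_radialPoly_succ s n r
    have b1 := radialPoly_angular s m r
    have b2 := radialPoly_angular (s + 1) n r
    simp only [radial, id, Pi.mul_apply]
    push_cast at *
    rw [← exp_half_mul_exp_half]
    set E := Real.exp (-r ^ 2 / 2)
    linear_combination E * E * (-2 * r * radialPoly (s + 1) n r * a1
      - radialPoly (s + 1) n r * b1 + radialPoly s m r * b2)
  have hi : ∀ a b c d : ℕ, IntegrableOn (fun r => radial a b r * radial c d r * r) (Ioi 0) :=
    fun a b c d => (integrable_radial_mul_mul a b c d).integrableOn
  have hi1 : IntegrableOn (fun r => √((s : ℝ) + 1) * (2 * (radial (s + 1) m r * radial (s + 1) n r * r)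
        - 2 * (radial s m r * radial s n r * r))) (Ioi 0) :=
    (((hi _ _ _ _).const_mul 2).sub ((hi _ _ _ _).const_mul 2)).const_mul _
  have hi2 : IntegrableOn (fun r => ((m : ℝ) - n) * (radial s m r * radial (s + 1) n r)) (Ioi 0) :=
    ((integrable_radial_mul s m (s + 1) n).const_mul _).integrableOn
  have ht : Tendsto (fun r => r * (radialPoly s m r * radialPoly (s + 1) n r) * Real.exp (-r ^ 2))
      atTop (𝓝 0) := by
    convert tendsto_eval_mul_exp_neg_sq (Polynomial.X * (P * Q)) using 2 with r
    simp [hP, hQ]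
  have key := integral_Ioi_of_hasDerivAt_of_tendsto' (a := 0) (fun r _ => hd r) (hi1.sub hi2) ht
  rw [integral_sub hi1 hi2, integral_const_mul, integral_const_mul,
    integral_sub ((hi _ _ _ _).const_mul 2) ((hi _ _ _ _).const_mul 2), integral_const_mul,
    integral_const_mul] at key
  simp only [zero_mul, sub_zero] at key
  rw [overlap, overlap]
  linarith

lemma overlap_zero (m n : ℕ) :
    overlap 0 m n = Real.Gamma (((m + n : ℕ) : ℝ) / 2 + 1)
      / (√(m.factorial : ℝ) * √(n.factorial : ℝ)) := by
  have h := integral_rpow_mul_exp_neg_rpow (p := 2) (q := ((m + n + 1 : ℕ) : ℝ)) two_pos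
    (by linarith [(m + n + 1).cast_nonneg (α := ℝ)])
  have h2 : ∀ r ∈ Ioi (0 : ℝ), radial 0 m r * radial 0 n r * r
      = (1 / (√(m.factorial : ℝ) * √(n.factorial : ℝ))) *
        (r ^ (((m + n + 1 : ℕ) : ℝ)) * Real.exp (-r ^ (2 : ℝ))) := by
    intro r _
    rw [radial, radial, radialPoly_zero, radialPoly_zero, Real.rpow_natCast, Real.rpow_two,
      ← exp_half_mul_exp_half]
    field_simp
    ring
  rw [overlap, setIntegral_congr_fun measurableSet_Ioi h2, integral_const_mul, h]
  have : (((m + n + 1 : ℕ) : ℝ) + 1) / 2 = ((m + n : ℕ) : ℝ) / 2 + 1 := by push_cast; ring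
  rw [this]
  ring

/-- For `m = n` the right side of `overlap_succ` vanishes, so the value is that at `s = 0`, namely
`Γ(n+1)/n!`. This normalization lies behind both `E_T(𝕋) = I` and all integrability estimates. -/
lemma overlap_self (s n : ℕ) : overlap s n n = 1 := by
  induction s with
  | zero =>
    rw [overlap_zero, Real.mul_self_sqrt (by positivity)]
    have : ((n + n : ℕ) : ℝ) / 2 + 1 = n + 1 := by push_cast; ring
    rw [this, Real.Gamma_nat_eq_factorial]
    exact div_self (by positivity)
  | succ s ih =>
    have h := overlap_succ s n n
    have hs : √((s : ℝ) + 1) ≠ 0 := by positivity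
    rw [sub_self, zero_mul, mul_eq_zero, or_iff_right hs, ih] at h
    linarith

lemma overlap_comm (s m n : ℕ) : overlap s m n = overlap s n m := by
  simp only [overlap, mul_comm (radial s m _)]

lemma integral_norm_radial_le (s m n : ℕ) :
    ∫ r in Ioi (0 : ℝ), ‖radial s m r * radial s n r * r‖ ≤ 1 / 2 := by
  have hi : ∀ a b : ℕ, IntegrableOn (fun r => radial s a r * radial s b r * r) (Ioi 0) :=
    fun a b => (integrable_radial_mul_mul s a s b).integrableOn
  have h1 := overlap_self s m
  have h2 := overlap_self s n
  rw [overlap] at h1 h2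
  have h3 : ∫ r in Ioi (0 : ℝ), ‖radial s m r * radial s n r * r‖
      ≤ ∫ r in Ioi (0 : ℝ), (1 / 2 * (radial s m r * radial s m r * r)
        + 1 / 2 * (radial s n r * radial s n r * r)) := by
    refine setIntegral_mono_on (hi _ _).norm (((hi _ _).const_mul _).add ((hi _ _).const_mul _))
      measurableSet_Ioi fun r hr => ?_
    have hr : (0 : ℝ) < r := hr
    rw [norm_mul, norm_mul, Real.norm_of_nonneg hr.le, Real.norm_eq_abs, Real.norm_eq_abs]
    nlinarith [sq_nonneg (|radial s m r| - |radial s n r|), abs_mul_abs_self (radial s m r),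
      abs_mul_abs_self (radial s n r)]
  rw [integral_add ((hi _ _).const_mul _) ((hi _ _).const_mul _), integral_const_mul,
    integral_const_mul] at h3
  linarith

lemma abs_overlap_le (s m n : ℕ) : |overlap s m n| ≤ 1 := by
  have h := norm_integral_le_integral_norm (μ := volume.restrict (Ioi (0 : ℝ)))
    (fun r => radial s m r * radial s n r * r)
  have h2 := integral_norm_radial_le s m n
  rw [overlap, abs_mul, abs_two]
  rw [Real.norm_eq_abs] at h
  linarith

end Radial

/-! ### Matrix elements of the shift operators -/

section MatrixElements

lemma raising_apply (x : ℕ →₀ ℂ) (m : ℕ) :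
    raising x m = ((√(m : ℝ) : ℝ) : ℂ) * x (m - 1) := by
  induction x using Finsupp.induction_linear with
  | zero => simp
  | add x y hx hy => simp only [map_add, Finsupp.add_apply, hx, hy]; ring
  | single n c =>
    rcases m with _ | m
    · simp [raising]
    · by_cases h : n = m
      · subst h; simp [raising, mul_comm]
      · simp [raising, h]

lemma lowering_apply (x : ℕ →₀ ℂ) (m : ℕ) :
    lowering x m = ((√((m : ℝ) + 1) : ℝ) : ℂ) * x (m + 1) := by
  induction x using Finsupp.induction_linear with
  | zero => simp
  | add x y hx hy => simp only [map_add, Finsupp.add_apply, hx, hy]; ring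
  | single n c =>
    rcases n with _ | n
    · simp [lowering]
    · by_cases h : n = m
      · subst h; simp [lowering, mul_comm]
      · simp [lowering, h]

lemma lowering_mul_raising : lowering * raising = raising * lowering + 1 := by
  refine LinearMap.ext fun x => Finsupp.ext fun m => ?_
  have hm : ((√((m : ℝ) + 1) : ℝ) : ℂ) * ((√((m : ℝ) + 1) : ℝ) : ℂ) = (m : ℂ) + 1 := by
    rw [← Complex.ofReal_mul, Real.mul_self_sqrt (by positivity)]; push_cast; rfl
  have hm' : ((√(m : ℝ) : ℝ) : ℂ) * ((√(m : ℝ) : ℝ) : ℂ) = (m : ℂ) := by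
    rw [← Complex.ofReal_mul, Real.mul_self_sqrt (by positivity)]; push_cast; rfl
  simp only [Module.End.mul_apply, LinearMap.add_apply, Finsupp.add_apply, Module.End.one_apply,
    lowering_apply, raising_apply]
  rcases m with _ | m
  · simp
  · push_cast at *
    linear_combination x (m + 1) * hm - x (m + 1) * hm'

lemma raising_mul_shiftGen (z : ℂ) :
    raising * shiftGen z = shiftGen z * raising + starRingEnd ℂ z • 1 := by
  refine LinearMap.ext fun x => ?_
  have h : lowering (raising x) = raising (lowering x) + x :=
    LinearMap.congr_fun lowering_mul_raising x
  simp only [shiftGen, Module.End.mul_apply, LinearMap.add_apply, LinearMap.sub_apply,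
    LinearMap.smul_apply, Module.End.one_apply, map_sub, map_smul, h]
  module

lemma lowering_mul_shiftGen (z : ℂ) :
    lowering * shiftGen z = shiftGen z * lowering + z • 1 := by
  refine LinearMap.ext fun x => ?_
  have h : lowering (raising x) = raising (lowering x) + x :=
    LinearMap.congr_fun lowering_mul_raising x
  simp only [shiftGen, Module.End.mul_apply, LinearMap.add_apply, LinearMap.sub_apply,
    LinearMap.smul_apply, Module.End.one_apply, map_sub, map_smul, h]
  module

/-- A scalar commutator makes `[B, ·]` act on powers of `A` like `c · d/dA`. At `k = 0` the
truncated exponent is multiplied by `0`. -/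
lemma mul_pow_of_commutator {R : Type*} [Ring R] [Algebra ℂ R] {A B : R} {c : ℂ}
    (h : B * A = A * B + c • 1) (k : ℕ) :
    B * A ^ k = A ^ k * B + ((k : ℂ) * c) • A ^ (k - 1) := by
  induction k with
  | zero => simp
  | succ k ih =>
    rcases k with _ | k
    · simpa using h
    · rw [pow_succ, ← mul_assoc, ih, add_mul, mul_assoc, h, mul_add, smul_mul_assoc]
      simp only [Nat.add_sub_cancel, ← pow_succ, mul_smul_comm, mul_one, ← mul_assoc]
      push_cast
      module

variable {H : Type*} [NormedAddCommGroup H] [InnerProductSpace ℂ H]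
variable (e : HilbertBasis ℕ ℂ H)

lemma inner_finVec (m : ℕ) (x : ℕ →₀ ℂ) : ⟪e m, finVec e x⟫_ℂ = x m := by
  simp only [finVec]
  exact e.orthonormal.inner_right_finsupp x m

lemma hasSum_norm_inner_sq (x : H) : HasSum (fun m => ‖⟪e m, x⟫_ℂ‖ ^ 2) (‖x‖ ^ 2) := by
  have h := e.hasSum_inner_mul_inner x x
  rw [inner_self_eq_norm_sq_to_K] at h
  have h2 := Complex.hasSum_re h
  convert h2 using 1
  · funext m
    rw [← inner_conj_symm x, Complex.conj_mul']
    norm_cast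
  · norm_cast

variable [CompleteSpace H]

lemma hasSum_inner_shiftVec (z : ℂ) (m n : ℕ) :
    HasSum (fun k : ℕ => ((k.factorial : ℂ)⁻¹) * (shiftGen z ^ k) (Finsupp.single n 1) m)
      ⟪e m, shiftVec e z n⟫_ℂ := by
  have h := (hasSum_shiftTerm e z n).mapL (innerSL ℂ (e m))
  simpa [shiftTerm, inner_smul_right, inner_finVec] using h

/-- Since `k/k! = 1/(k-1)!`, the commutator terms are the exponential series shifted by one. This
carries the commutation relations over to `D(z)` at the level of matrix elements, with no domain
questions for `a` and `a*`. -/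
lemma hasSum_commutator_term (z c : ℂ) (m n : ℕ) :
    HasSum (fun k : ℕ => ((k.factorial : ℂ)⁻¹) *
        (((k : ℂ) * c) • shiftGen z ^ (k - 1)) (Finsupp.single n 1) m)
      (c * ⟪e m, shiftVec e z n⟫_ℂ) := by
  rw [← hasSum_nat_add_iff' 1]
  have h := (hasSum_inner_shiftVec e z m n).mul_left c
  have hz : ∑ i ∈ Finset.range 1, ((i.factorial : ℂ)⁻¹) *
      (((i : ℂ) * c) • shiftGen z ^ (i - 1)) (Finsupp.single n 1) m = 0 := by simp
  rw [hz, sub_zero]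
  refine HasSum.congr_fun h fun k => ?_
  · have hk : ((k : ℂ) + 1) ≠ 0 := by exact_mod_cast k.succ_ne_zero
    have hk' : (k.factorial : ℂ) ≠ 0 := by exact_mod_cast k.factorial_ne_zero
    simp only [Nat.add_sub_cancel, LinearMap.smul_apply, Finsupp.smul_apply, smul_eq_mul,
      Nat.factorial_succ]
    push_cast
    field_simp

/-- The matrix form of `a* D(z) = D(z) a* + conj z D(z)`; it passes from column `n` to column `n +
1`. -/
lemma raising_relation (z : ℂ) (m n : ℕ) :
    ((√(m : ℝ) : ℝ) : ℂ) * ⟪e (m - 1), shiftVec e z n⟫_ℂ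
      = ((√((n : ℝ) + 1) : ℝ) : ℂ) * ⟪e m, shiftVec e z (n + 1)⟫_ℂ
        + starRingEnd ℂ z * ⟪e m, shiftVec e z n⟫_ℂ := by
  have h1 := (hasSum_inner_shiftVec e z (m - 1) n).mul_left ((√(m : ℝ) : ℝ) : ℂ)
  have h2 := ((hasSum_inner_shiftVec e z m (n + 1)).mul_left ((√((n : ℝ) + 1) : ℝ) : ℂ)).add
    (hasSum_commutator_term e z (starRingEnd ℂ z) m n)
  refine h1.unique ?_
  refine HasSum.congr_fun h2 fun k => ?_
  have h := congrArg (fun A : Module.End ℂ (ℕ →₀ ℂ) => A (Finsupp.single n 1) m)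
    (mul_pow_of_commutator (raising_mul_shiftGen z) k)
  simp only [Module.End.mul_apply, LinearMap.add_apply, Finsupp.add_apply, raising_apply] at h
  have hr : raising (Finsupp.single n (1 : ℂ))
      = ((√((n : ℝ) + 1) : ℝ) : ℂ) • Finsupp.single (n + 1) (1 : ℂ) := by simp [raising]
  rw [hr, map_smul, Finsupp.smul_apply, smul_eq_mul] at h
  linear_combination ((k.factorial : ℂ)⁻¹) * h

/-- The matrix form of `a D(z) = D(z) a + z D(z)` on the vacuum, where `a|0⟩ = 0`; it generates
column `0` from its first entry. -/
lemma lowering_relation (z : ℂ) (m : ℕ) :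
    ((√((m : ℝ) + 1) : ℝ) : ℂ) * ⟪e (m + 1), shiftVec e z 0⟫_ℂ = z * ⟪e m, shiftVec e z 0⟫_ℂ := by
  have h1 := (hasSum_inner_shiftVec e z (m + 1) 0).mul_left ((√((m : ℝ) + 1) : ℝ) : ℂ)
  have h2 := hasSum_commutator_term e z z m 0
  refine h1.unique ?_
  refine HasSum.congr_fun h2 fun k => ?_
  have h := congrArg (fun A : Module.End ℂ (ℕ →₀ ℂ) => A (Finsupp.single 0 1) m)
    (mul_pow_of_commutator (lowering_mul_shiftGen z) k)
  simp only [Module.End.mul_apply, LinearMap.add_apply, Finsupp.add_apply, lowering_apply] at h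
  have hr : lowering (Finsupp.single 0 (1 : ℂ)) = 0 := by simp [lowering]
  rw [hr, map_zero, Finsupp.zero_apply, zero_add] at h
  linear_combination ((k.factorial : ℂ)⁻¹) * h

/-- The angular factor `exp(i(m-s)θ)`. -/
noncomputable def angular (m s : ℕ) (θ : ℝ) : ℂ :=
  Complex.exp (Complex.I * ((m : ℂ) - (s : ℂ)) * (θ : ℂ))

/-- Column `0` follows from the vacuum amplitude by `lowering_relation`, the other columns by
`raising_relation`, which is the defining recursion of `radialPoly` once the phases are split off.
-/
lemma inner_shiftVec_polar_aux (r θ : ℝ) (s m : ℕ) :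
    ⟪e m, shiftVec e ((r : ℂ) * (Circle.exp θ : ℂ)) s⟫_ℂ
      = ⟪e 0, shiftVec e ((r : ℂ) * (Circle.exp θ : ℂ)) 0⟫_ℂ
        * (angular m s θ * (radialPoly s m r : ℂ)) := by
  set z := (r : ℂ) * (Circle.exp θ : ℂ) with hz
  have hzc : starRingEnd ℂ z = r * Complex.exp (-(Complex.I * θ)) := by
    rw [hz, map_mul, Complex.conj_ofReal, Circle.coe_exp, ← Complex.exp_conj]
    congr 2
    simp [mul_comm]
  induction s generalizing m with
  | zero =>
    induction m with
    | zero => simp [angular, radialPoly_zero]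
    | succ m ih =>
      have hs : ((√((m : ℝ) + 1) : ℝ) : ℂ) ≠ 0 := by
        exact_mod_cast (by positivity : √((m : ℝ) + 1) ≠ 0)
      apply mul_left_cancel₀ hs
      rw [lowering_relation, ih]
      have h1 := congrArg (fun x : ℝ => (x : ℂ)) (sqrt_mul_radialPoly_zero_succ m r)
      have h2 : angular (m + 1) 0 θ = Complex.exp (θ * Complex.I) * angular m 0 θ := by
        rw [angular, angular, ← Complex.exp_add]; congr 1; push_cast; ring
      rw [h2]
      nth_rewrite 1 [hz]
      rw [Circle.coe_exp]
      push_cast at h1 ⊢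
      linear_combination -⟪e 0, shiftVec e z 0⟫_ℂ * Complex.exp (θ * Complex.I)
        * angular m 0 θ * h1
  | succ s ih =>
    have hs : ((√((s : ℝ) + 1) : ℝ) : ℂ) ≠ 0 := by
      exact_mod_cast (by positivity : √((s : ℝ) + 1) ≠ 0)
    apply mul_left_cancel₀ hs
    have h0 := raising_relation e z m s
    rw [ih, ih m, hzc] at h0
    have h1 := congrArg (fun x : ℝ => (x : ℂ)) (sqrt_mul_radialPoly_succ s m r)
    have h2 : angular m (s + 1) θ = Complex.exp (-(Complex.I * θ)) * angular m s θ := by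
      rw [angular, angular, ← Complex.exp_add]; congr 1; push_cast; ring
    have h3 : ((√(m : ℝ) : ℝ) : ℂ) * angular (m - 1) s θ
        = ((√(m : ℝ) : ℝ) : ℂ) * (Complex.exp (-(Complex.I * θ)) * angular m s θ) := by
      rcases m with _ | m
      · simp
      · rw [angular, angular, ← Complex.exp_add]; congr 2; push_cast; ring
    rw [h2]
    push_cast at h1 ⊢
    linear_combination -h0 - ⟪e 0, shiftVec e z 0⟫_ℂ * Complex.exp (-(Complex.I * θ))
        * angular m s θ * h1 + ⟪e 0, shiftVec e z 0⟫_ℂ * radialPoly s (m - 1) r * h3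

lemma norm_angular (m s : ℕ) (θ : ℝ) : ‖angular m s θ‖ = 1 := by
  rw [angular, Complex.norm_exp]
  simp

lemma continuous_angular (m s : ℕ) : Continuous (angular m s) := by
  unfold angular
  fun_prop

/-- The matrix elements of the shift operators in polar coordinates, up to a phase. -/
lemma exists_phase_inner_shiftVec (r θ : ℝ) :
    ∃ ω : ℂ, ‖ω‖ = 1 ∧ ∀ s m, ⟪e m, shiftVec e ((r : ℂ) * (Circle.exp θ : ℂ)) s⟫_ℂ
      = ω * (angular m s θ * (radial s m r : ℂ)) := by
  set z := (r : ℂ) * (Circle.exp θ : ℂ) with hz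
  set g := ⟪e 0, shiftVec e z 0⟫_ℂ with hg
  have h1 := hasSum_norm_inner_sq e (shiftVec e z 0)
  rw [(orthonormal_shiftVec e z).1 0, one_pow] at h1
  have h2 : HasSum (fun m : ℕ => ‖g‖ ^ 2 * ((r ^ 2) ^ m / m.factorial))
      (‖g‖ ^ 2 * Real.exp (r ^ 2)) := by
    rw [Real.exp_eq_exp_ℝ]
    exact (NormedSpace.expSeries_div_hasSum_exp (r ^ 2)).mul_left _
  -- The modulus of the vacuum amplitude comes from `‖D(z)|0⟩‖ = 1`. Its phase is left undetermined,
  -- since it cancels in `D T D*`.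
  have h3 : ‖g‖ ^ 2 * Real.exp (r ^ 2) = 1 := by
    refine h2.unique ?_
    convert h1 using 2 with m
    rw [hz, inner_shiftVec_polar_aux, ← hz, ← hg, norm_mul, norm_mul, norm_angular, one_mul,
      Complex.norm_real, mul_pow, radialPoly_zero, norm_div, div_pow,
      Real.norm_of_nonneg (Real.sqrt_nonneg _), Real.sq_sqrt (by positivity), norm_pow,
      ← pow_mul, ← pow_mul, mul_comm m 2, pow_mul, Real.norm_eq_abs, pow_mul |r|, sq_abs]
  refine ⟨g * Real.exp (r ^ 2 / 2), ?_, fun s m => ?_⟩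
  · rw [norm_mul, Complex.norm_real, Real.norm_of_nonneg (Real.exp_pos _).le]
    have h4 : (‖g‖ * Real.exp (r ^ 2 / 2)) ^ 2 = 1 := by
      rw [mul_pow, ← Real.exp_nat_mul, ← h3]
      congr 2
      push_cast; ring
    exact (pow_eq_one_iff_of_nonneg (by positivity) two_ne_zero).1 h4
  · rw [hz, inner_shiftVec_polar_aux, ← hz, ← hg, radial]
    have h5 : (Real.exp (r ^ 2 / 2) : ℂ) * (Real.exp (-r ^ 2 / 2) : ℂ) = 1 := by
      rw [← Complex.ofReal_mul, ← Real.exp_add]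
      rw [show r ^ 2 / 2 + -r ^ 2 / 2 = 0 by ring]; simp
    rw [Complex.ofReal_mul]
    linear_combination -g * angular m s θ * radialPoly s m r * h5

end MatrixElements

/-! ### Asymptotics of the overlaps -/

section Asymptotics

open MeasureTheory Filter Topology Set

lemma hasSum_radial_sq (s : ℕ) (r : ℝ) : HasSum (fun m => radial s m r ^ 2) 1 := by
  -- No Hilbert space is given here; `ℓ²` serves as a model in which `D(r)|s⟩` is a unit vector with
  -- these coefficients up to phases.
  let e : HilbertBasis ℕ ℂ (lp (fun _ : ℕ => ℂ) 2) :=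
    HilbertBasis.ofRepr (LinearIsometryEquiv.refl ℂ _)
  obtain ⟨ω, hω, h⟩ := exists_phase_inner_shiftVec e r 0
  have h1 := hasSum_norm_inner_sq e (shiftVec e ((r : ℂ) * (Circle.exp 0 : ℂ)) s)
  rw [(orthonormal_shiftVec e _).1 s, one_pow] at h1
  refine HasSum.congr_fun h1 fun m => ?_
  rw [h, norm_mul, norm_mul, hω, norm_angular, Complex.norm_real, one_mul, one_mul,
    Real.norm_eq_abs, sq_abs]

lemma radial_sq_le_one (s m : ℕ) (r : ℝ) : radial s m r ^ 2 ≤ 1 :=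
  le_hasSum (hasSum_radial_sq s r) m fun _ _ => sq_nonneg _

/-- The measure is `dr`, not `r dr`. On a bounded interval the integrand tends to `0` pointwise,
being summable in `m`, and is dominated by `1`; beyond `R = 1/ε` the missing weight gains the factor
`ε` over `∫ f² r dr = 1/2`. -/
lemma tendsto_integral_radial_sq (s : ℕ) :
    Tendsto (fun m => ∫ r in Ioi (0 : ℝ), radial s m r ^ 2) atTop (𝓝 0) := by
  have hint : ∀ m, Integrable fun r => radial s m r ^ 2 := fun m => by
    simpa [sq] using integrable_radial_mul s m s m
  have hint' : ∀ m, Integrable fun r => radial s m r ^ 2 * r := fun m => by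
    simpa [sq] using integrable_radial_mul_mul s m s m
  have h0 : ∀ m, 0 ≤ ∫ r in Ioi (0 : ℝ), radial s m r ^ 2 := fun m =>
    integral_nonneg fun r => sq_nonneg _
  have hbd : ∀ R : ℝ, Tendsto (fun m => ∫ r in Ioc 0 R, radial s m r ^ 2) atTop (𝓝 0) := by
    intro R
    have := tendsto_integral_of_dominated_convergence (μ := volume.restrict (Ioc 0 R))
      (F := fun m r => radial s m r ^ 2) (f := fun _ => 0) (fun _ => 1)
      (fun m => (hint m).integrableOn.aestronglyMeasurable) (integrable_const _)
      (fun m => Eventually.of_forall fun r => by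
        rw [Real.norm_of_nonneg (sq_nonneg _)]; exact radial_sq_le_one s m r)
      (Eventually.of_forall fun r => (hasSum_radial_sq s r).summable.tendsto_atTop_zero)
    simpa using this
  rw [Metric.tendsto_atTop]
  intro ε hε
  have hR : 0 < 1 / ε := by positivity
  obtain ⟨N, hN⟩ := Metric.tendsto_atTop.1 (hbd (1 / ε)) (ε / 2) (by positivity)
  refine ⟨N, fun m hm => ?_⟩
  have h1 := hN m hm
  rw [Real.dist_eq, sub_zero] at h1 ⊢
  rw [abs_of_nonneg (h0 m)]
  have hsplit : ∫ r in Ioi (0 : ℝ), radial s m r ^ 2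
      = (∫ r in Ioc 0 (1 / ε), radial s m r ^ 2) + ∫ r in Ioi (1 / ε), radial s m r ^ 2 := by
    rw [← setIntegral_union (Ioc_disjoint_Ioi le_rfl) measurableSet_Ioi (hint m).integrableOn
      (hint m).integrableOn, Ioc_union_Ioi_eq_Ioi hR.le]
  have htail : ∫ r in Ioi (1 / ε), radial s m r ^ 2 ≤ ε * (1 / 2) := by
    have h2 : ∫ r in Ioi (1 / ε), radial s m r ^ 2
        ≤ ∫ r in Ioi (1 / ε), ε * (radial s m r ^ 2 * r) := by
      refine setIntegral_mono_on (hint m).integrableOn ((hint' m).const_mul ε).integrableOn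
        measurableSet_Ioi fun r hr => ?_
      have h3 : 1 ≤ ε * r := by
        have : 1 / ε < r := hr
        rw [div_lt_iff₀ hε] at this
        linarith
      nlinarith [sq_nonneg (radial s m r)]
    rw [integral_const_mul] at h2
    have h4 : ∫ r in Ioi (1 / ε), radial s m r ^ 2 * r ≤ ∫ r in Ioi 0, radial s m r ^ 2 * r := by
      refine setIntegral_mono_set (hint' m).integrableOn ?_
        (Ioi_subset_Ioi hR.le).eventuallyLE
      filter_upwards [self_mem_ae_restrict measurableSet_Ioi] with r hr
      have : (0 : ℝ) < r := hr
      simp only [Pi.zero_apply]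
      positivity
    have h5 := overlap_self s m
    rw [overlap] at h5
    simp only [← sq] at h5
    refine h2.trans (mul_le_mul_of_nonneg_left ?_ hε.le)
    linarith
  linarith [le_abs_self (∫ r in Ioc 0 (1 / ε), radial s m r ^ 2)]

lemma Gamma_add_nat_le {x : ℝ} (hx : 0 < x) (k : ℕ) :
    Real.Gamma (x + k) ≤ Real.Gamma x * (x + k) ^ k := by
  induction k with
  | zero => simp
  | succ k ih =>
    have hp : 0 < x + k := by positivity
    have hG := Real.Gamma_pos_of_pos hx
    have h : x + ((k + 1 : ℕ) : ℝ) = (x + k) + 1 := by push_cast; ring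
    rw [h, Real.Gamma_add_one hp.ne']
    calc (x + k) * Real.Gamma (x + k) ≤ (x + k) * (Real.Gamma x * (x + k) ^ k) := by gcongr
      _ = Real.Gamma x * (x + k) ^ (k + 1) := by ring
      _ ≤ Real.Gamma x * (x + k + 1) ^ (k + 1) :=
          mul_le_mul_of_nonneg_left (pow_le_pow_left₀ hp.le (by linarith) _) hG.le

/-- With `x = m + k/2 + 1`, the overlap is `Γ(x)/√(m! (m+k)!)`. The point `m + k + 1` is the
midpoint of `x` and `x + k`, so log-convexity gives `(m+k)!² ≤ Γ(x) Γ(x+k) ≤ Γ(x)² (x+k)^k`; then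
`m! (m+1)^k ≤ (m+k)!` is used. -/
lemma le_overlap_zero (m k : ℕ) :
    (((m + 1 : ℕ) : ℝ) / (((m + 1 : ℕ) : ℝ) + 3 * k / 2)) ^ k ≤ overlap 0 m (m + k) := by
  set x : ℝ := ((m + (m + k) : ℕ) : ℝ) / 2 + 1 with hx
  have hx0 : 0 < x := by positivity
  have hG := Real.Gamma_pos_of_pos hx0
  have hmf : (0 : ℝ) < m.factorial := by positivity
  have hkf : (0 : ℝ) < (m + k).factorial := by positivity
  have h1 : ((m + k).factorial : ℝ) ^ 2 ≤ Real.Gamma x ^ 2 * (x + k) ^ k := by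
    have hc := Real.Gamma_mul_add_mul_le_rpow_Gamma_mul_rpow_Gamma (s := x) (t := x + k)
      (a := 1 / 2) (b := 1 / 2) hx0 (by positivity) (by norm_num) (by norm_num) (by norm_num)
    have he : 1 / 2 * x + 1 / 2 * (x + k) = ((m + k : ℕ) : ℝ) + 1 := by
      rw [hx]; push_cast; ring
    have hG2 := Real.Gamma_pos_of_pos (show 0 < x + k by positivity)
    rw [he, Real.Gamma_nat_eq_factorial, ← Real.sqrt_eq_rpow, ← Real.sqrt_eq_rpow] at hc
    calc ((m + k).factorial : ℝ) ^ 2 ≤ (√(Real.Gamma x) * √(Real.Gamma (x + k))) ^ 2 := by gcongr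
      _ = Real.Gamma x * Real.Gamma (x + k) := by
        rw [mul_pow, Real.sq_sqrt hG.le, Real.sq_sqrt hG2.le]
      _ ≤ Real.Gamma x * (Real.Gamma x * (x + k) ^ k) := by
        gcongr
        exact Gamma_add_nat_le hx0 k
      _ = _ := by ring
  have h2 : (m.factorial : ℝ) * ((m + 1 : ℕ) : ℝ) ^ k ≤ (m + k).factorial := by
    exact_mod_cast Nat.factorial_mul_pow_le_factorial
  have hxk : x + k = ((m + 1 : ℕ) : ℝ) + 3 * k / 2 := by rw [hx]; push_cast; ring
  have ho : overlap 0 m (m + k) ^ 2 = Real.Gamma x ^ 2 / (m.factorial * (m + k).factorial) := by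
    rw [overlap_zero, div_pow, mul_pow, Real.sq_sqrt hmf.le, Real.sq_sqrt hkf.le]
  have h0 : 0 ≤ overlap 0 m (m + k) := by rw [overlap_zero]; positivity
  have hle := (abs_le.1 (abs_overlap_le 0 m (m + k))).2
  -- As the overlap lies in `[0,1]`, its square is a lower bound, which removes the square roots.
  refine le_trans ?_ (show overlap 0 m (m + k) ^ 2 ≤ _ by nlinarith)
  rw [ho, ← hxk, div_pow, div_le_div_iff₀ (by positivity) (by positivity)]
  calc ((m + 1 : ℕ) : ℝ) ^ k * (m.factorial * (m + k).factorial)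
      = (m.factorial * ((m + 1 : ℕ) : ℝ) ^ k) * (m + k).factorial := by ring
    _ ≤ (m + k).factorial * (m + k).factorial := by gcongr
    _ ≤ _ := by rw [← sq]; exact h1

/-- By `overlap_succ`, passing from `s` to `s + 1` changes the overlap by `-k/√(s+1)` times an
integral that the two vanishing integrals of squares control. -/
lemma tendsto_overlap (s k : ℕ) : Tendsto (fun m => overlap s m (m + k)) atTop (𝓝 1) := by
  induction s with
  | zero =>
    have h := ((tendsto_natCast_div_add_atTop (3 * (k : ℝ) / 2)).comp
      (tendsto_add_atTop_nat 1)).pow k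
    rw [one_pow] at h
    exact tendsto_of_tendsto_of_tendsto_of_le_of_le h tendsto_const_nhds
      (fun m => le_overlap_zero m k) fun m => (abs_le.1 (abs_overlap_le 0 m (m + k))).2
  | succ s ih =>
    have hs : 0 < √((s : ℝ) + 1) := by positivity
    have h1 : Tendsto (fun m => ∫ r in Ioi (0 : ℝ), radial s m r * radial (s + 1) (m + k) r) atTop
        (𝓝 0) := by
      have h2 := ((tendsto_integral_radial_sq s).add
        ((tendsto_integral_radial_sq (s + 1)).comp (tendsto_add_atTop_nat k)))
      rw [add_zero] at h2
      refine squeeze_zero_norm (fun m => ?_) h2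
      have ha : Integrable (fun r => radial s m r ^ 2) (volume.restrict (Ioi 0)) := by
        simpa [sq] using (integrable_radial_mul s m s m).restrict (s := Ioi (0 : ℝ))
      have hb : Integrable (fun r => radial (s + 1) (m + k) r ^ 2) (volume.restrict (Ioi 0)) := by
        simpa [sq] using (integrable_radial_mul (s + 1) (m + k) (s + 1) (m + k)).restrict (s := Ioi (0 : ℝ))
      simp only [Function.comp]
      rw [← integral_add ha hb]
      refine norm_integral_le_of_norm_le (ha.add hb) (Eventually.of_forall fun r => ?_)
      rw [Real.norm_eq_abs, abs_mul, ← sq_abs (radial s m r), ← sq_abs (radial (s + 1) (m + k) r)]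
      nlinarith [sq_nonneg (|radial s m r| - |radial (s + 1) (m + k) r|),
        abs_nonneg (radial s m r), abs_nonneg (radial (s + 1) (m + k) r)]
    have h3 := ih.add (h1.const_mul (-(k : ℝ) / √((s : ℝ) + 1)))
    rw [mul_zero, add_zero] at h3
    refine h3.congr fun m => ?_
    have h4 := overlap_succ s m (m + k)
    push_cast at h4
    field_simp
    linarith

end Asymptotics

/-! ### Square integrability and the operators generated by a diagonal state -/

section Generated

open MeasureTheory Filter Topology Set

lemma angular_self (m : ℕ) (θ : ℝ) : angular m m θ = 1 := by simp [angular]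

lemma conj_angular (m n : ℕ) (θ : ℝ) : starRingEnd ℂ (angular m n θ) = angular n m θ := by
  rw [angular, ← Complex.exp_conj, angular]
  congr 1
  simp
  ring

lemma angular_mul_angular (m s n : ℕ) (θ : ℝ) : angular m s θ * angular s n θ = angular m n θ := by
  rw [angular, angular, ← Complex.exp_add, angular]
  congr 1
  ring

lemma angular_periodic (m n : ℕ) : Function.Periodic (angular m n) (2 * Real.pi) := by
  intro θ
  rw [angular, angular, Complex.exp_eq_exp_iff_exists_int]
  exact ⟨(m : ℤ) - n, by push_cast; ring⟩

lemma integral_angular (m n : ℕ) :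
    ∫ θ in Ico 0 (2 * Real.pi), angular m n θ = if m = n then ((2 * Real.pi : ℝ) : ℂ) else 0 := by
  split_ifs with h
  · subst h
    simp [angular_self, Real.pi_pos.le]
  · rw [integral_Ico_eq_integral_Ioc, ← intervalIntegral.integral_of_le (by positivity)]
    have hc : Complex.I * ((m : ℂ) - n) ≠ 0 := by
      simp [sub_eq_zero, h]
    simp only [angular]
    rw [integral_exp_mul_complex hc]
    have := angular_periodic m n 0
    simp only [angular, zero_add] at this
    rw [this, sub_self, zero_div]

/-- The measure `dθ dr` on the strip `[0, 2π) × (0, ∞)`. -/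
noncomputable def stripMeasure : Measure (ℝ × ℝ) :=
  volume.restrict (Ico 0 (2 * Real.pi) ×ˢ Ioi 0)

lemma stripMeasure_eq_prod : stripMeasure =
    (volume.restrict (Ico 0 (2 * Real.pi))).prod (volume.restrict (Ioi (0 : ℝ))) := by
  rw [stripMeasure, Measure.prod_restrict, Measure.volume_eq_prod]

lemma ae_stripMeasure_pos : ∀ᵐ p ∂stripMeasure, 0 < p.2 := by
  have h : MeasurableSet (Ico 0 (2 * Real.pi) ×ˢ Ioi (0 : ℝ)) :=
    measurableSet_Ico.prod measurableSet_Ioi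
  filter_upwards [ae_restrict_mem h] with p hp using hp.2

/-- The finite combinations of matrix elements. -/
noncomputable def partialElement (s : ℕ) (a : ℕ → ℂ) (N : ℕ) (p : ℝ × ℝ) : ℂ :=
  ∑ m ∈ Finset.range N, a m * (angular m s p.1 * (radial s m p.2 : ℂ))

lemma continuous_partialElement (s : ℕ) (a : ℕ → ℂ) (N : ℕ) :
    Continuous (partialElement s a N) := by
  unfold partialElement
  have := continuous_angular
  have := continuous_radial
  fun_prop

lemma integral_angular_mul_radial (s m n : ℕ) :
    Integrable (fun p : ℝ × ℝ => angular m n p.1 * ((radial s m p.2 * radial s n p.2 * p.2 : ℝ) : ℂ))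
      stripMeasure ∧
    ∫ p, angular m n p.1 * ((radial s m p.2 * radial s n p.2 * p.2 : ℝ) : ℂ) ∂stripMeasure
      = if m = n then (Real.pi : ℂ) else 0 := by
  rw [stripMeasure_eq_prod]
  have h1 : Integrable (angular m n) (volume.restrict (Ico 0 (2 * Real.pi))) :=
    ((continuous_angular m n).integrableOn_Icc (a := 0) (b := 2 * Real.pi)).mono_set
      Ico_subset_Icc_self
  have h2 : Integrable (fun r : ℝ => ((radial s m r * radial s n r * r : ℝ) : ℂ))
      (volume.restrict (Ioi (0 : ℝ))) := ((integrable_radial_mul_mul s m s n).restrict).ofReal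
  refine ⟨h1.mul_prod h2, ?_⟩
  rw [integral_prod_mul (angular m n) (fun r : ℝ => ((radial s m r * radial s n r * r : ℝ) : ℂ)),
    integral_angular]
  split_ifs with h
  · subst h
    have h3 := overlap_self s m
    rw [overlap] at h3
    rw [integral_complex_ofReal, ← Complex.ofReal_mul]
    congr 1
    linear_combination Real.pi * h3
  · rw [zero_mul]

/-- Parseval's identity: for fixed `s` the functions `e^{i(m-s)θ} f_{s,m}(r)` are orthogonal in
`L²(r dr dθ)` with squared norm `π`. -/
lemma lintegral_partialElement (s : ℕ) (a : ℕ → ℂ) (N : ℕ) :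
    ∫⁻ p, ENNReal.ofReal (‖partialElement s a N p‖ ^ 2 * p.2) ∂stripMeasure
      = ENNReal.ofReal (Real.pi * ∑ m ∈ Finset.range N, ‖a m‖ ^ 2) := by
  have hexp : ∀ p : ℝ × ℝ, ((‖partialElement s a N p‖ ^ 2 * p.2 : ℝ) : ℂ)
      = ∑ m ∈ Finset.range N, ∑ n ∈ Finset.range N, a m * starRingEnd ℂ (a n) *
        (angular m n p.1 * ((radial s m p.2 * radial s n p.2 * p.2 : ℝ) : ℂ)) := by
    intro p
    have h : ((‖partialElement s a N p‖ ^ 2 : ℝ) : ℂ)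
        = partialElement s a N p * starRingEnd ℂ (partialElement s a N p) := by
      rw [Complex.mul_conj']; norm_cast
    rw [Complex.ofReal_mul, h, partialElement, map_sum, Finset.sum_mul_sum, Finset.sum_mul]
    refine Finset.sum_congr rfl fun m _ => ?_
    rw [Finset.sum_mul]
    refine Finset.sum_congr rfl fun n _ => ?_
    rw [map_mul, map_mul, conj_angular, Complex.conj_ofReal, ← angular_mul_angular m s n]
    push_cast
    ring
  have hint : ∀ m n : ℕ, Integrable (fun p : ℝ × ℝ => a m * starRingEnd ℂ (a n) *
        (angular m n p.1 * ((radial s m p.2 * radial s n p.2 * p.2 : ℝ) : ℂ))) stripMeasure :=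
    fun m n => (integral_angular_mul_radial s m n).1.const_mul _
  have hI : Integrable (fun p => ((‖partialElement s a N p‖ ^ 2 * p.2 : ℝ) : ℂ)) stripMeasure := by
    simp_rw [hexp]
    exact integrable_finsetSum _ fun m _ => integrable_finsetSum _ fun n _ => hint m n
  have hval : ∫ p, ((‖partialElement s a N p‖ ^ 2 * p.2 : ℝ) : ℂ) ∂stripMeasure
      = ((Real.pi * ∑ m ∈ Finset.range N, ‖a m‖ ^ 2 : ℝ) : ℂ) := by
    simp_rw [hexp]
    rw [integral_finsetSum _ fun m _ => integrable_finsetSum _ fun n _ => hint m n]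
    rw [Finset.mul_sum, Complex.ofReal_sum]
    refine Finset.sum_congr rfl fun m hm => ?_
    rw [integral_finsetSum _ fun n _ => hint m n]
    simp_rw [integral_const_mul, (integral_angular_mul_radial s m _).2]
    rw [Finset.sum_eq_single m]
    · rw [if_pos rfl, Complex.mul_conj', mul_comm]
      push_cast
      rfl
    · intro n _ hn
      rw [if_neg hn.symm, mul_zero]
    · exact fun h => absurd hm h
  have hR : Integrable (fun p => ‖partialElement s a N p‖ ^ 2 * p.2) stripMeasure := by
    exact hI.re
  rw [← ofReal_integral_eq_lintegral_ofReal hR]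
  · congr 1
    rw [integral_complex_ofReal] at hval
    exact_mod_cast hval
  · filter_upwards [ae_stripMeasure_pos] with p hp
    simp only [Pi.zero_apply]
    positivity

variable {H : Type*} [NormedAddCommGroup H] [InnerProductSpace ℂ H]
variable (e : HilbertBasis ℕ ℂ H)

/-- The matrix element `⟨u|D(re^{iθ})|s⟩`, up to a phase. -/
noncomputable def matElement (s : ℕ) (u : H) (p : ℝ × ℝ) : ℂ :=
  ∑' m, ⟪u, e m⟫_ℂ * (angular m s p.1 * (radial s m p.2 : ℂ))

lemma matElement_basis (s m : ℕ) (p : ℝ × ℝ) :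
    matElement e s (e m) p = angular m s p.1 * (radial s m p.2 : ℂ) := by
  rw [matElement, tsum_eq_single m]
  · rw [orthonormal_iff_ite.1 e.orthonormal, if_pos rfl, one_mul]
  · intro n hn
    rw [orthonormal_iff_ite.1 e.orthonormal, if_neg hn.symm, zero_mul]

lemma norm_sesquilinear_le (f : H →ₗ⋆[ℂ] H →ₗ[ℂ] ℂ)
    (hf : ∀ u v, ‖f u v‖ ≤ 1 / 2 * (‖u‖ ^ 2 + ‖v‖ ^ 2)) (u v : H) : ‖f u v‖ ≤ 1 * ‖u‖ * ‖v‖ := by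
  rcases eq_or_ne u 0 with rfl | hu
  · simp
  rcases eq_or_ne v 0 with rfl | hv
  · simp
  have hu' := norm_pos_iff.2 hu
  have hv' := norm_pos_iff.2 hv
  have h := hf (((‖u‖⁻¹ : ℝ) : ℂ) • u) (((‖v‖⁻¹ : ℝ) : ℂ) • v)
  rw [map_smul, LinearMap.map_smulₛₗ, LinearMap.smul_apply, norm_smul, norm_smul, norm_smul,
    norm_smul, RCLike.norm_conj, Complex.norm_real, Complex.norm_real, norm_inv, norm_inv,
    norm_norm, norm_norm, inv_mul_cancel₀ hu'.ne', inv_mul_cancel₀ hv'.ne'] at h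
  have h2 : ‖f u v‖ = ‖u‖ * ‖v‖ * (‖u‖⁻¹ * (‖v‖⁻¹ * ‖f u v‖)) := by field_simp
  rw [h2]
  have h3 : ‖u‖⁻¹ * (‖v‖⁻¹ * ‖f u v‖) ≤ 1 := by linarith
  nlinarith [mul_pos hu' hv']

variable [CompleteSpace H]

/-- One `ω` serves all `s` and `u`, as needed for cancellation in `D T D*`. The `HasSum` part
ensures that the series in `matElement` really converges. -/
lemma exists_phase_matElement (p : ℝ × ℝ) :
    ∃ ω : ℂ, ‖ω‖ = 1 ∧ ∀ s (u : H),
      ⟪u, shiftVec e ((p.2 : ℂ) * (Circle.exp p.1 : ℂ)) s⟫_ℂ = ω * matElement e s u p ∧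
      HasSum (fun m => ⟪u, e m⟫_ℂ * (angular m s p.1 * (radial s m p.2 : ℂ)))
        (matElement e s u p) := by
  obtain ⟨ω, hω, h⟩ := exists_phase_inner_shiftVec e p.2 p.1
  have hω0 : ω ≠ 0 := fun h0 => by simp [h0] at hω
  refine ⟨ω, hω, fun s u => ?_⟩
  have h1 := (e.hasSum_inner_mul_inner u
    (shiftVec e ((p.2 : ℂ) * (Circle.exp p.1 : ℂ)) s)).mul_left ω⁻¹
  have h2 : HasSum (fun m => ⟪u, e m⟫_ℂ * (angular m s p.1 * (radial s m p.2 : ℂ)))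
      (ω⁻¹ * ⟪u, shiftVec e ((p.2 : ℂ) * (Circle.exp p.1 : ℂ)) s⟫_ℂ) := by
    refine HasSum.congr_fun h1 fun m => ?_
    rw [h]
    field_simp
  have h3 := h2.tsum_eq
  rw [← matElement] at h3
  refine ⟨?_, h3 ▸ h2⟩
  rw [h3]
  field_simp

lemma hasSum_matElement (s : ℕ) (u : H) (p : ℝ × ℝ) :
    HasSum (fun m => ⟪u, e m⟫_ℂ * (angular m s p.1 * (radial s m p.2 : ℂ))) (matElement e s u p) := by
  obtain ⟨ω, -, h⟩ := exists_phase_matElement e p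
  exact (h s u).2

lemma tendsto_partialElement (s : ℕ) (u : H) (p : ℝ × ℝ) :
    Tendsto (fun N => partialElement s (fun m => ⟪u, e m⟫_ℂ) N p) atTop
      (𝓝 (matElement e s u p)) :=
  (hasSum_matElement e s u p).tendsto_sum_nat

lemma measurable_matElement (s : ℕ) (u : H) : Measurable (matElement e s u) :=
  measurable_of_tendsto_metrizable
    (fun N => (continuous_partialElement s (fun m => ⟪u, e m⟫_ℂ) N).measurable)
    (tendsto_pi_nhds.2 fun p => tendsto_partialElement e s u p)

lemma lintegral_matElement_le (s : ℕ) (u : H) :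
    ∫⁻ p, ENNReal.ofReal (‖matElement e s u p‖ ^ 2 * p.2) ∂stripMeasure
      ≤ ENNReal.ofReal (Real.pi * ‖u‖ ^ 2) := by
  set a : ℕ → ℂ := fun m => ⟪u, e m⟫_ℂ with ha
  have hm : ∀ N, Measurable fun p : ℝ × ℝ =>
      ENNReal.ofReal (‖partialElement s a N p‖ ^ 2 * p.2) := fun N => by
    have := (continuous_partialElement s a N).measurable
    fun_prop
  have hlim : ∀ p : ℝ × ℝ, ENNReal.ofReal (‖matElement e s u p‖ ^ 2 * p.2)
      = liminf (fun N => ENNReal.ofReal (‖partialElement s a N p‖ ^ 2 * p.2)) atTop := fun p =>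
    (Tendsto.liminf_eq (ENNReal.tendsto_ofReal
      (((tendsto_partialElement e s u p).norm.pow 2).mul_const p.2))).symm
  simp_rw [hlim]
  -- Fatou's lemma: the finite sums are bounded by Parseval and Bessel, and only an upper bound is
  -- needed.
  refine (lintegral_liminf_le hm).trans ?_
  refine liminf_le_of_le (by isBoundedDefault) fun b hb => ?_
  obtain ⟨N, hN⟩ := hb.exists
  refine hN.trans ?_
  rw [lintegral_partialElement]
  refine ENNReal.ofReal_le_ofReal (mul_le_mul_of_nonneg_left ?_ Real.pi_pos.le)
  have h := hasSum_norm_inner_sq e u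
  refine (Finset.sum_congr rfl fun m _ => ?_).trans_le
    (sum_le_hasSum (Finset.range N) (fun _ _ => sq_nonneg _) h)
  rw [ha, norm_inner_symm]

variable {T : H →L[ℂ] H} {l : ℕ → ℝ}

/-- Expanding `T` gives products `⟨u|D|s⟩ conj ⟨v|D|s⟩`, in which the phase enters only as `ω conj ω
= 1`. -/
lemma hasSum_stateDensity
    (hT : HasSum (fun n => (l n : ℂ) • InnerProductSpace.rankOne ℂ (e n) (e n)) T)
    (u v : H) (p : ℝ × ℝ) :
    HasSum (fun s => (l s : ℂ) * (matElement e s u p * starRingEnd ℂ (matElement e s v p)) * (p.2 : ℂ))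
      (stateDensity e T u v p) := by
  obtain ⟨ω, hω, h⟩ := exists_phase_matElement e p
  set D := shiftOp e ((p.2 : ℂ) * (Circle.exp p.1 : ℂ)) with hD
  have h1 := (((hT.mapL (ContinuousLinearMap.apply ℂ H (D.adjoint v))).mapL D).mapL
    (innerSL ℂ u)).mul_right (p.2 : ℂ)
  refine HasSum.congr_fun h1 fun s => ?_
  have hDs : D (e s) = shiftVec e ((p.2 : ℂ) * (Circle.exp p.1 : ℂ)) s := by
    rw [hD, shiftOp, mapBasis_apply]
  have hω2 : ω * starRingEnd ℂ ω = 1 := by rw [Complex.mul_conj', hω]; simp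
  simp only [ContinuousLinearMap.apply_apply,
    InnerProductSpace.rankOne_apply, map_smul, innerSL_apply_apply, hDs,
    (h s u).1, ContinuousLinearMap.adjoint_inner_right]
  rw [← inner_conj_symm, (h s v).1, map_mul]
  simp only [smul_eq_mul]
  linear_combination -(l s : ℂ) * matElement e s u p * starRingEnd ℂ (matElement e s v p) * p.2 * hω2

lemma measurable_stateDensity
    (hT : HasSum (fun n => (l n : ℂ) • InnerProductSpace.rankOne ℂ (e n) (e n)) T) (u v : H) :
    Measurable (stateDensity e T u v) := by
  have hm := measurable_matElement e
  refine measurable_of_tendsto_metrizable (f := fun N p => ∑ s ∈ Finset.range N,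
    (l s : ℂ) * (matElement e s u p * starRingEnd ℂ (matElement e s v p)) * (p.2 : ℂ)) (fun N => ?_)
    (tendsto_pi_nhds.2 fun p => (hasSum_stateDensity e hT u v p).tendsto_sum_nat)
  have h2 : ∀ s, Measurable fun p => starRingEnd ℂ (matElement e s v p) := fun s =>
    Complex.continuous_conj.measurable.comp (hm s v)
  fun_prop

lemma hasSum_re_stateDensity_self
    (hT : HasSum (fun n => (l n : ℂ) • InnerProductSpace.rankOne ℂ (e n) (e n)) T)
    (u : H) (p : ℝ × ℝ) :
    HasSum (fun s => l s * (‖matElement e s u p‖ ^ 2 * p.2)) (stateDensity e T u u p).re := by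
  refine HasSum.congr_fun (Complex.hasSum_re (hasSum_stateDensity e hT u u p)) fun s => ?_
  rw [Complex.mul_conj', mul_assoc]
  norm_cast

lemma stateDensity_self_eq_re
    (hT : HasSum (fun n => (l n : ℂ) • InnerProductSpace.rankOne ℂ (e n) (e n)) T)
    (u : H) (p : ℝ × ℝ) :
    stateDensity e T u u p = ((stateDensity e T u u p).re : ℂ) := by
  refine (hasSum_stateDensity e hT u u p).unique ?_
  refine HasSum.congr_fun (Complex.hasSum_ofReal.2 (hasSum_re_stateDensity_self e hT u p))
    fun s => ?_
  rw [Complex.mul_conj', mul_assoc]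
  norm_cast

lemma re_stateDensity_self_nonneg (hl : ∀ n, 0 ≤ l n)
    (hT : HasSum (fun n => (l n : ℂ) • InnerProductSpace.rankOne ℂ (e n) (e n)) T)
    (u : H) {p : ℝ × ℝ} (hp : 0 < p.2) : 0 ≤ (stateDensity e T u u p).re :=
  (hasSum_re_stateDensity_self e hT u p).nonneg fun s => by
    have := hl s
    positivity

lemma norm_stateDensity_le (hl : ∀ n, 0 ≤ l n)
    (hT : HasSum (fun n => (l n : ℂ) • InnerProductSpace.rankOne ℂ (e n) (e n)) T)
    (u v : H) {p : ℝ × ℝ} (hp : 0 < p.2) :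
    ‖stateDensity e T u v p‖
      ≤ 1 / 2 * ((stateDensity e T u u p).re + (stateDensity e T v v p).re) := by
  have h1 := ((hasSum_re_stateDensity_self e hT u p).add
    (hasSum_re_stateDensity_self e hT v p)).mul_left (1 / 2)
  rw [← (hasSum_stateDensity e hT u v p).tsum_eq]
  refine tsum_of_norm_bounded h1 fun s => ?_
  rw [norm_mul, norm_mul, norm_mul, RCLike.norm_conj, Complex.norm_real, Complex.norm_real,
    Real.norm_of_nonneg (hl s), Real.norm_of_nonneg hp.le]
  have h2 : 0 ≤ l s * p.2 := mul_nonneg (hl s) hp.le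
  nlinarith [mul_nonneg h2 (sq_nonneg (‖matElement e s u p‖ - ‖matElement e s v p‖))]

/-- Tonelli for the nonnegative terms: each `s` contributes at most `λₛ π ‖u‖²`. -/
lemma integrable_re_stateDensity_self (hl : ∀ n, 0 ≤ l n) (hl1 : HasSum l 1)
    (hT : HasSum (fun n => (l n : ℂ) • InnerProductSpace.rankOne ℂ (e n) (e n)) T) (u : H) :
    Integrable (fun p => (stateDensity e T u u p).re) stripMeasure ∧
      ∫ p, (stateDensity e T u u p).re ∂stripMeasure ≤ Real.pi * ‖u‖ ^ 2 := by
  have hm : Measurable fun p => (stateDensity e T u u p).re :=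
    Complex.measurable_re.comp (measurable_stateDensity e hT u u)
  have hnn : 0 ≤ᵐ[stripMeasure] fun p => (stateDensity e T u u p).re := by
    filter_upwards [ae_stripMeasure_pos] with p hp using re_stateDensity_self_nonneg e hl hT u hp
  have hle : ∫⁻ p, ENNReal.ofReal (stateDensity e T u u p).re ∂stripMeasure
      ≤ ENNReal.ofReal (Real.pi * ‖u‖ ^ 2) := by
    calc ∫⁻ p, ENNReal.ofReal (stateDensity e T u u p).re ∂stripMeasure
        = ∫⁻ p, ∑' s, ENNReal.ofReal (l s) * ENNReal.ofReal (‖matElement e s u p‖ ^ 2 * p.2)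
            ∂stripMeasure := by
          refine lintegral_congr_ae ?_
          filter_upwards [ae_stripMeasure_pos] with p hp
          have h := hasSum_re_stateDensity_self e hT u p
          rw [← h.tsum_eq, ENNReal.ofReal_tsum_of_nonneg (fun s => by have := hl s; positivity)
            h.summable]
          exact tsum_congr fun s => ENNReal.ofReal_mul (hl s)
      _ = ∑' s, ENNReal.ofReal (l s) *
            ∫⁻ p, ENNReal.ofReal (‖matElement e s u p‖ ^ 2 * p.2) ∂stripMeasure := by
          have hme := fun s => measurable_matElement e s u
          rw [lintegral_tsum fun s => by fun_prop]
          exact tsum_congr fun s => lintegral_const_mul _ (by fun_prop)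
      _ ≤ ∑' s, ENNReal.ofReal (l s) * ENNReal.ofReal (Real.pi * ‖u‖ ^ 2) :=
          ENNReal.tsum_le_tsum fun s => mul_le_mul_right (lintegral_matElement_le e s u) _
      _ = ENNReal.ofReal (Real.pi * ‖u‖ ^ 2) := by
          rw [ENNReal.tsum_mul_right, ← ENNReal.ofReal_tsum_of_nonneg hl hl1.summable, hl1.tsum_eq,
            ENNReal.ofReal_one, one_mul]
  refine ⟨⟨hm.aestronglyMeasurable, ?_⟩, ?_⟩
  · rw [hasFiniteIntegral_iff_ofReal hnn]
    exact hle.trans_lt ENNReal.ofReal_lt_top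
  · rw [integral_eq_lintegral_of_nonneg_ae hnn hm.aestronglyMeasurable]
    exact ENNReal.toReal_le_of_le_ofReal (by positivity) hle

lemma integrable_stateDensity (hl : ∀ n, 0 ≤ l n) (hl1 : HasSum l 1)
    (hT : HasSum (fun n => (l n : ℂ) • InnerProductSpace.rankOne ℂ (e n) (e n)) T) (u v : H) :
    Integrable (stateDensity e T u v) stripMeasure := by
  refine Integrable.mono' (((integrable_re_stateDensity_self e hl hl1 hT u).1.add
    (integrable_re_stateDensity_self e hl hl1 hT v).1).const_mul (1 / 2))
    (measurable_stateDensity e hT u v).aestronglyMeasurable ?_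
  filter_upwards [ae_stripMeasure_pos] with p hp using norm_stateDensity_le e hl hT u v hp

lemma argSet_prod_subset (X : Set Circle) :
    argSet X ×ˢ Ioi (0 : ℝ) ⊆ Ico 0 (2 * Real.pi) ×ˢ Ioi 0 :=
  prod_mono (fun _ h => h.1) subset_rfl

lemma integrableOn_stateDensity (hl : ∀ n, 0 ≤ l n) (hl1 : HasSum l 1)
    (hT : HasSum (fun n => (l n : ℂ) • InnerProductSpace.rankOne ℂ (e n) (e n)) T) (u v : H)
    (X : Set Circle) : IntegrableOn (stateDensity e T u v) (argSet X ×ˢ Ioi 0) :=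
  IntegrableOn.mono_set (integrable_stateDensity e hl hl1 hT u v) (argSet_prod_subset X)

lemma norm_setIntegral_stateDensity_le (hl : ∀ n, 0 ≤ l n) (hl1 : HasSum l 1)
    (hT : HasSum (fun n => (l n : ℂ) • InnerProductSpace.rankOne ℂ (e n) (e n)) T) (u v : H)
    (X : Set Circle) :
    ‖∫ p in argSet X ×ˢ Ioi 0, stateDensity e T u v p‖
      ≤ Real.pi * (1 / 2 * (‖u‖ ^ 2 + ‖v‖ ^ 2)) := by
  obtain ⟨hu, hu'⟩ := integrable_re_stateDensity_self e hl hl1 hT u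
  obtain ⟨hv, hv'⟩ := integrable_re_stateDensity_self e hl hl1 hT v
  calc ‖∫ p in argSet X ×ˢ Ioi 0, stateDensity e T u v p‖
      ≤ ∫ p in argSet X ×ˢ Ioi 0, ‖stateDensity e T u v p‖ := norm_integral_le_integral_norm _
    _ ≤ ∫ p, ‖stateDensity e T u v p‖ ∂stripMeasure :=
        setIntegral_mono_set (integrable_stateDensity e hl hl1 hT u v).norm
          (Eventually.of_forall fun _ => norm_nonneg _) (argSet_prod_subset X).eventuallyLE
    _ ≤ ∫ p, 1 / 2 * ((stateDensity e T u u p).re + (stateDensity e T v v p).re) ∂stripMeasure := by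
        refine integral_mono_ae (integrable_stateDensity e hl hl1 hT u v).norm
          ((hu.add hv).const_mul _) ?_
        filter_upwards [ae_stripMeasure_pos] with p hp using norm_stateDensity_le e hl hT u v hp
    _ ≤ _ := by
        rw [integral_const_mul, integral_add hu hv]
        linarith

lemma exists_isStateIntegral (hT : IsDiagonalState e T) (X : Set Circle) :
    ∃ A, IsStateIntegral e T X A := by
  obtain ⟨l, hl, hl1, hT⟩ := hT
  have hi := integrableOn_stateDensity e hl hl1 hT (X := X)
  let f : H →ₗ⋆[ℂ] H →ₗ[ℂ] ℂ := LinearMap.mk₂'ₛₗ (starRingEnd ℂ) (RingHom.id ℂ)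
    (fun u v => ((Real.pi : ℝ) : ℂ)⁻¹ * ∫ p in argSet X ×ˢ Ioi 0, stateDensity e T u v p)
    (fun u u' v => by
      rw [← mul_add, ← integral_add (hi _ _) (hi _ _)]
      simp only [stateDensity, inner_add_left, add_mul])
    (fun c u v => by
      simp only [stateDensity, inner_smul_left, mul_assoc, integral_const_mul, smul_eq_mul]
      ring)
    (fun u v v' => by
      rw [← mul_add, ← integral_add (hi _ _) (hi _ _)]
      simp only [stateDensity, map_add, inner_add_right, add_mul])
    (fun c u v => by
      simp only [stateDensity, map_smul, inner_smul_right, mul_assoc, integral_const_mul,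
        smul_eq_mul, RingHom.id_apply]
      ring)
  have hf : ∀ u v, ‖f u v‖ ≤ 1 / 2 * (‖u‖ ^ 2 + ‖v‖ ^ 2) := fun u v => by
    have h := norm_setIntegral_stateDensity_le e hl hl1 hT u v X
    change ‖((Real.pi : ℝ) : ℂ)⁻¹ * ∫ p in argSet X ×ˢ Ioi 0, stateDensity e T u v p‖ ≤ _
    rw [norm_mul, norm_inv, Complex.norm_real, Real.norm_of_nonneg Real.pi_pos.le,
      inv_mul_le_iff₀ Real.pi_pos]
    exact h
  let B := f.mkContinuous₂ 1 (norm_sesquilinear_le f hf)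
  -- The Riesz operator of `B` acts on the first argument of the inner product, hence the adjoint.
  refine ⟨(InnerProductSpace.continuousLinearMapOfBilin B).adjoint, fun u v => ⟨hi u v, ?_⟩⟩
  rw [ContinuousLinearMap.adjoint_inner_right, InnerProductSpace.continuousLinearMapOfBilin_apply,
    ← setIntegral_prod _ (hi u v)]
  rfl

lemma isStateIntegral_stateGenerated (hT : IsDiagonalState e T) (X : Set Circle) :
    IsStateIntegral e T X (stateGenerated e T X) := by
  have h := exists_isStateIntegral e hT X
  rw [stateGenerated, dif_pos h]
  exact h.choose_spec

lemma inner_stateGenerated (hT : IsDiagonalState e T) (X : Set Circle) (u v : H) :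
    ⟪u, stateGenerated e T X v⟫_ℂ
      = ((Real.pi : ℝ) : ℂ)⁻¹ * ∫ p in argSet X ×ˢ Ioi 0, stateDensity e T u v p := by
  obtain ⟨h1, h2⟩ := isStateIntegral_stateGenerated e hT X u v
  rw [h2]
  congr 1
  exact (setIntegral_prod _ h1).symm

end Generated

/-! ### The phase observable generated by a diagonal state -/

section PhaseObservable

open MeasureTheory Filter Topology Set

/-! ### Argument sets and their behaviour under rotation. -/

lemma argSet_eq (X : Set Circle) : argSet X = Ico 0 (2 * Real.pi) ∩ Circle.exp ⁻¹' X := rfl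

lemma measurableSet_argSet {X : Set Circle} (hX : MeasurableSet[borel Circle] X) :
    MeasurableSet (argSet X) := by
  let _ : MeasurableSpace Circle := borel Circle
  have : BorelSpace Circle := ⟨rfl⟩
  exact measurableSet_Ico.inter (Circle.exp.continuous.measurable hX)

lemma argSet_univ : argSet univ = Ico 0 (2 * Real.pi) := by simp [argSet_eq]

lemma argSet_empty : argSet ∅ = ∅ := by simp [argSet_eq]

lemma argSet_iUnion (X : ℕ → Set Circle) : argSet (⋃ i, X i) = ⋃ i, argSet (X i) := by
  simp only [argSet_eq, preimage_iUnion, inter_iUnion]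

lemma disjoint_argSet {X Y : Set Circle} (h : Disjoint X Y) : Disjoint (argSet X) (argSet Y) :=
  (h.preimage Circle.exp).mono inter_subset_right inter_subset_right

lemma angular_add (m n : ℕ) (θ φ : ℝ) : angular m n (θ + φ) = angular m n θ * angular m n φ := by
  rw [angular, angular, angular, ← Complex.exp_add]
  congr 1
  push_cast
  ring

lemma angular_eq_pow (m n : ℕ) (θ : ℝ) :
    angular m n θ = (Circle.exp θ : ℂ) ^ m * starRingEnd ℂ (Circle.exp θ : ℂ) ^ n := by
  rw [Circle.coe_exp, ← Complex.exp_conj, ← Complex.exp_nat_mul, ← Complex.exp_nat_mul,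
    ← Complex.exp_add, angular]
  congr 1
  simp
  ring

lemma setIntegral_argSet_angular {X : Set Circle} (hX : MeasurableSet[borel Circle] X) (m n : ℕ) :
    ∫ θ in argSet X, angular m n θ
      = ∫ θ in (0 : ℝ)..2 * Real.pi, (Circle.exp ⁻¹' X).indicator (angular m n) θ := by
  let _ : MeasurableSpace Circle := borel Circle
  have : BorelSpace Circle := ⟨rfl⟩
  rw [intervalIntegral.integral_of_le (by positivity), ← integral_Ico_eq_integral_Ioc,
    setIntegral_indicator (Circle.exp.continuous.measurable hX), argSet_eq]

lemma measurableSet_rotate (t : Circle) {X : Set Circle} (hX : MeasurableSet[borel Circle] X) :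
    MeasurableSet[borel Circle] ((fun s => t * s) '' X) := by
  let _ : MeasurableSpace Circle := borel Circle
  have : BorelSpace Circle := ⟨rfl⟩
  exact (Homeomorph.mulLeft t).toMeasurableEquiv.measurableSet_image.2 hX

/-- Rotation need not translate `argSet X` inside `[0, 2π)`. Extending the integrand periodically
turns it into a translation, under which integrals over a period are invariant. -/
lemma setIntegral_argSet_rotate (t : Circle) {X : Set Circle} (hX : MeasurableSet[borel Circle] X)
    (m n : ℕ) :
    ∫ θ in argSet ((fun s => t * s) '' X), angular m n θ
      = (t : ℂ) ^ m * starRingEnd ℂ (t : ℂ) ^ n * ∫ θ in argSet X, angular m n θ := by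
  obtain ⟨φ, rfl⟩ : ∃ φ, Circle.exp φ = t := ⟨Complex.arg t, Circle.exp_arg t⟩
  set F := (Circle.exp ⁻¹' X).indicator (angular m n) with hF
  have hper : Function.Periodic F (2 * Real.pi) := by
    intro θ
    have h : θ + 2 * Real.pi ∈ Circle.exp ⁻¹' X ↔ θ ∈ Circle.exp ⁻¹' X := by
      rw [mem_preimage, Circle.exp_add, Circle.exp_two_pi, mul_one, mem_preimage]
    by_cases h' : θ ∈ Circle.exp ⁻¹' X
    · rw [hF, indicator_of_mem (h.2 h'), indicator_of_mem h', angular_periodic m n θ]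
    · rw [hF, indicator_of_notMem (mt h.1 h'), indicator_of_notMem h']
  have hrot : ∀ θ, (Circle.exp ⁻¹' ((fun s => Circle.exp φ * s) '' X)).indicator (angular m n) θ
      = angular m n φ * F (θ - φ) := by
    intro θ
    have hiff : θ ∈ Circle.exp ⁻¹' ((fun s => Circle.exp φ * s) '' X)
        ↔ θ - φ ∈ Circle.exp ⁻¹' X := by
      simp only [mem_preimage, mem_image, Circle.exp_sub]
      constructor
      · rintro ⟨s, hs, h⟩
        rw [← h, mul_div_cancel_left]
        exact hs
      · exact fun h => ⟨_, h, by rw [mul_div_cancel]⟩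
    by_cases h : θ - φ ∈ Circle.exp ⁻¹' X
    · rw [indicator_of_mem (hiff.2 h), hF, indicator_of_mem h, ← angular_add]
      congr 1
      ring
    · rw [indicator_of_notMem (mt hiff.1 h), hF, indicator_of_notMem h, mul_zero]
  rw [setIntegral_argSet_angular (measurableSet_rotate _ hX), setIntegral_argSet_angular hX]
  simp_rw [hrot]
  rw [intervalIntegral.integral_const_mul, ← angular_eq_pow,
    intervalIntegral.integral_comp_sub_right F φ]
  congr 1
  have h := hper.intervalIntegral_add_eq (0 - φ) 0
  rw [zero_add] at h
  rw [← h]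
  congr 1
  ring

variable {H : Type*} [NormedAddCommGroup H] [InnerProductSpace ℂ H]
variable (e : HilbertBasis ℕ ℂ H)

lemma ext_inner_basis {x y : H} (h : ∀ m, ⟪e m, x⟫_ℂ = ⟪e m, y⟫_ℂ) : x = y :=
  e.repr.injective (lp.ext (funext fun m => by
    rw [e.repr_apply_apply, e.repr_apply_apply, h]))

lemma ext_matrix_elements {A B : H →L[ℂ] H}
    (h : ∀ m n, ⟪e m, A (e n)⟫_ℂ = ⟪e m, B (e n)⟫_ℂ) : A = B := by
  refine ContinuousLinearMap.ext fun x => ((e.hasSum_repr x).mapL A).unique ?_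
  refine HasSum.congr_fun ((e.hasSum_repr x).mapL B) fun n => ?_
  rw [map_smul, map_smul, ext_inner_basis e fun m => h m n]

variable [CompleteSpace H]

lemma adjoint_numberRep_apply (t : Circle) (n : ℕ) :
    (numberRep e t).adjoint (e n) = (starRingEnd ℂ (t : ℂ) ^ n) • e n := by
  refine ext_inner_basis e fun m => ?_
  rw [ContinuousLinearMap.adjoint_inner_right, numberRep_apply, inner_smul_left, inner_smul_right,
    orthonormal_iff_ite.1 e.orthonormal, map_pow]
  split_ifs with h
  · rw [h]
  · simp

/-- The matrix `∑ₛ λₛ ⟨f_{m,s}, f_{n,s}⟩` of overlaps. -/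
noncomputable def overlapMatrix (l : ℕ → ℝ) : Matrix ℕ ℕ ℂ :=
  fun m n => ((∑' s, l s * overlap s m n : ℝ) : ℂ)

lemma summable_overlap {l : ℕ → ℝ} (hl : ∀ n, 0 ≤ l n) (hl1 : HasSum l 1) (m n : ℕ) :
    Summable fun s => l s * overlap s m n := by
  refine Summable.of_norm_bounded hl1.summable fun s => ?_
  rw [norm_mul, Real.norm_of_nonneg (hl s)]
  exact mul_le_of_le_one_right (hl s) (abs_overlap_le s m n)

lemma tendsto_overlapMatrix {l : ℕ → ℝ} (hl : ∀ n, 0 ≤ l n) (hl1 : HasSum l 1) (k : ℕ) :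
    Tendsto (fun m => overlapMatrix l m (m + k)) atTop (𝓝 1) := by
  have h : Tendsto (fun m => ∑' s, l s * overlap s m (m + k)) atTop (𝓝 (∑' s, l s * 1)) := by
    refine tendsto_tsum_of_dominated_convergence hl1.summable
      (fun s => (tendsto_overlap s k).const_mul _) (Eventually.of_forall fun m s => ?_)
    rw [norm_mul, Real.norm_of_nonneg (hl s)]
    exact mul_le_of_le_one_right (hl s) (abs_overlap_le s m (m + k))
  simp_rw [mul_one] at h
  rw [hl1.tsum_eq] at h
  exact (Complex.continuous_ofReal.tendsto 1).comp h

lemma overlapMatrix_comm (l : ℕ → ℝ) (m n : ℕ) : overlapMatrix l m n = overlapMatrix l n m := by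
  simp only [overlapMatrix, overlap_comm _ m n]

lemma tendsto_overlapMatrix_add {l : ℕ → ℝ} (hl : ∀ n, 0 ≤ l n) (hl1 : HasSum l 1) (j k : ℕ) :
    Tendsto (fun N => overlapMatrix l (N + j) (N + k)) atTop (𝓝 1) := by
  wlog h : j ≤ k generalizing j k
  · simp_rw [overlapMatrix_comm l (_ + j)]
    exact this k j (le_of_not_ge h)
  have h1 := (tendsto_overlapMatrix hl hl1 (k - j)).comp (tendsto_add_atTop_nat j)
  refine h1.congr fun N => ?_
  simp only [Function.comp]
  congr 1
  omega

/-- Exhibits the overlaps as a Gram matrix; positivity of the phase matrix follows by averaging over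
`s`. -/
lemma sum_overlap_eq (s : ℕ) (S : Finset ℕ) (x : ℕ → ℂ) :
    ∑ i ∈ S, ∑ j ∈ S, starRingEnd ℂ (x i) * (overlap s i j : ℂ) * x j
      = ((2 * ∫ r in Ioi (0 : ℝ), ‖∑ i ∈ S, x i * (radial s i r : ℂ)‖ ^ 2 * r : ℝ) : ℂ) := by
  have hexp : ∀ r : ℝ, ((‖∑ i ∈ S, x i * (radial s i r : ℂ)‖ ^ 2 * r : ℝ) : ℂ)
      = ∑ i ∈ S, ∑ j ∈ S, starRingEnd ℂ (x i) * x j *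
        ((radial s i r * radial s j r * r : ℝ) : ℂ) := by
    intro r
    have h : ((‖∑ i ∈ S, x i * (radial s i r : ℂ)‖ ^ 2 : ℝ) : ℂ)
        = starRingEnd ℂ (∑ i ∈ S, x i * (radial s i r : ℂ)) * ∑ i ∈ S, x i * (radial s i r : ℂ) := by
      rw [Complex.conj_mul']; norm_cast
    rw [Complex.ofReal_mul, h, map_sum, Finset.sum_mul_sum, Finset.sum_mul]
    refine Finset.sum_congr rfl fun m _ => ?_
    rw [Finset.sum_mul]
    refine Finset.sum_congr rfl fun n _ => ?_
    rw [map_mul, Complex.conj_ofReal]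
    push_cast
    ring
  have hint : ∀ i j : ℕ, Integrable (fun r : ℝ => starRingEnd ℂ (x i) * x j *
      ((radial s i r * radial s j r * r : ℝ) : ℂ)) (volume.restrict (Ioi (0 : ℝ))) := fun i j =>
    ((integrable_radial_mul_mul s i s j).restrict).ofReal.const_mul _
  rw [Complex.ofReal_mul, ← integral_complex_ofReal]
  simp_rw [hexp]
  rw [integral_finsetSum _ fun i _ => integrable_finsetSum _ fun j _ => hint i j, Finset.mul_sum]
  refine Finset.sum_congr rfl fun i _ => ?_
  rw [integral_finsetSum _ fun j _ => hint i j, Finset.mul_sum]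
  refine Finset.sum_congr rfl fun j _ => ?_
  rw [integral_const_mul, integral_complex_ofReal, overlap, Complex.ofReal_mul]
  ring

lemma posSemidef_overlapMatrix {l : ℕ → ℝ} (hl : ∀ n, 0 ≤ l n) (hl1 : HasSum l 1) :
    (overlapMatrix l).PosSemidef := by
  refine ⟨?_, fun x => ?_⟩
  · ext m n
    rw [Matrix.conjTranspose_apply, overlapMatrix_comm]
    exact Complex.conj_ofReal _
  · have h : ∀ i j, HasSum (fun s => star (x i) * ((l s * overlap s i j : ℝ) : ℂ) * x j)
        (star (x i) * overlapMatrix l i j * x j) := fun i j =>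
      ((Complex.hasSum_ofReal.2 (summable_overlap hl hl1 i j).hasSum).mul_left _).mul_right _
    have h2 := hasSum_sum fun i (_ : i ∈ x.support) => hasSum_sum fun j (_ : j ∈ x.support) => h i j
    refine HasSum.nonneg (fun s => ?_) h2
    have h3 : ∑ i ∈ x.support, ∑ j ∈ x.support, star (x i) * ((l s * overlap s i j : ℝ) : ℂ) * x j
        = (l s : ℂ) * ∑ i ∈ x.support, ∑ j ∈ x.support,
          starRingEnd ℂ (x i) * (overlap s i j : ℂ) * x j := by
      simp_rw [Finset.mul_sum]
      refine Finset.sum_congr rfl fun i _ => Finset.sum_congr rfl fun j _ => ?_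
      rw [starRingEnd_apply]
      push_cast
      ring
    rw [h3, sum_overlap_eq, ← Complex.ofReal_mul, Complex.zero_le_real]
    have h4 : 0 ≤ ∫ r in Ioi (0 : ℝ), ‖∑ i ∈ x.support, x i * (radial s i r : ℂ)‖ ^ 2 * r :=
      setIntegral_nonneg measurableSet_Ioi fun r hr => mul_nonneg (sq_nonneg _) (le_of_lt hr)
    have := hl s
    positivity

lemma integral_tsum_radial {l : ℕ → ℝ} (hl : ∀ n, 0 ≤ l n) (hl1 : HasSum l 1) (m n : ℕ) :
    ∫ r in Ioi (0 : ℝ), ∑' s, l s * (radial s m r * radial s n r * r)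
      = 1 / 2 * ∑' s, l s * overlap s m n := by
  have h := hasSum_integral_of_summable_integral_norm (μ := volume.restrict (Ioi (0 : ℝ)))
    (F := fun s r => l s * (radial s m r * radial s n r * r))
    (fun s => ((integrable_radial_mul_mul s m s n).restrict).const_mul _) (by
      refine Summable.of_nonneg_of_le (fun s => integral_nonneg fun r => norm_nonneg _)
        (fun s => ?_) hl1.summable
      simp_rw [norm_mul (l s), Real.norm_of_nonneg (hl s)]
      rw [integral_const_mul]
      exact mul_le_of_le_one_right (hl s) ((integral_norm_radial_le s m n).trans (by norm_num)))
  rw [← h.tsum_eq, ← tsum_mul_left]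
  refine tsum_congr fun s => ?_
  rw [integral_const_mul, overlap]
  ring

variable {T : H →L[ℂ] H} {l : ℕ → ℝ}

/-- The angular factors `e^{i(m-s)θ}` and `e^{i(s-n)θ}` multiply to one independent of `s`, so the
two variables separate. Diagonality of `T` enters here. -/
lemma stateDensity_basis
    (hT : HasSum (fun n => (l n : ℂ) • InnerProductSpace.rankOne ℂ (e n) (e n)) T)
    (m n : ℕ) (θ r : ℝ) :
    stateDensity e T (e m) (e n) (θ, r)
      = angular m n θ * ((∑' s, l s * (radial s m r * radial s n r * r) : ℝ) : ℂ) := by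
  rw [← (hasSum_stateDensity e hT (e m) (e n) (θ, r)).tsum_eq, Complex.ofReal_tsum,
    ← tsum_mul_left]
  refine tsum_congr fun s => ?_
  rw [matElement_basis, matElement_basis, map_mul, conj_angular, Complex.conj_ofReal,
    ← angular_mul_angular m s n]
  push_cast
  ring

lemma inner_stateGenerated_basis (hl : ∀ n, 0 ≤ l n) (hl1 : HasSum l 1)
    (hT : HasSum (fun n => (l n : ℂ) • InnerProductSpace.rankOne ℂ (e n) (e n)) T)
    (X : Set Circle) (m n : ℕ) :
    ⟪e m, stateGenerated e T X (e n)⟫_ℂ = overlapMatrix l m n * ((2 * Real.pi : ℝ) : ℂ)⁻¹ *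
      ∫ θ in argSet X, angular m n θ := by
  rw [(isStateIntegral_stateGenerated e ⟨l, hl, hl1, hT⟩ X (e m) (e n)).2]
  simp_rw [stateDensity_basis e hT, integral_const_mul, integral_mul_const]
  rw [integral_complex_ofReal, integral_tsum_radial hl hl1, overlapMatrix]
  push_cast
  field_simp

lemma overlapMatrix_self (hl1 : HasSum l 1) (n : ℕ) : overlapMatrix l n n = 1 := by
  simp [overlapMatrix, overlap_self, hl1.tsum_eq]

lemma isPhaseMatrix_overlapMatrix (hl : ∀ n, 0 ≤ l n) (hl1 : HasSum l 1)
    (hT : HasSum (fun n => (l n : ℂ) • InnerProductSpace.rankOne ℂ (e n) (e n)) T) :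
    IsPhaseMatrix e (stateGenerated e T) (overlapMatrix l) :=
  ⟨posSemidef_overlapMatrix hl hl1, overlapMatrix_self hl1,
    fun m n X _ => inner_stateGenerated_basis e hl hl1 hT X m n⟩

lemma stateGenerated_univ (hT : IsDiagonalState e T) : stateGenerated e T univ = 1 := by
  obtain ⟨l, hl, hl1, hT⟩ := hT
  refine ext_matrix_elements e fun m n => ?_
  rw [inner_stateGenerated_basis e hl hl1 hT, argSet_univ, integral_angular,
    one_apply_eq_self, orthonormal_iff_ite.1 e.orthonormal]
  split_ifs with h
  · rw [h, overlapMatrix_self hl1, one_mul, inv_mul_cancel₀]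
    exact_mod_cast Real.two_pi_pos.ne'
  · rw [mul_zero]

lemma inner_stateGenerated_self (hT : IsDiagonalState e T) (X : Set Circle) (u : H) :
    ⟪u, stateGenerated e T X u⟫_ℂ
      = ((Real.pi⁻¹ * ∫ p in argSet X ×ˢ Ioi 0, (stateDensity e T u u p).re : ℝ) : ℂ) := by
  rw [inner_stateGenerated e hT]
  obtain ⟨l, hl, hl1, hT⟩ := hT
  rw [Complex.ofReal_mul, ← integral_complex_ofReal, Complex.ofReal_inv]
  simp_rw [← stateDensity_self_eq_re e hT]

lemma stateGenerated_nonneg (hT : IsDiagonalState e T) {X : Set Circle}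
    (hX : MeasurableSet[borel Circle] X) : 0 ≤ stateGenerated e T X := by
  rw [ContinuousLinearMap.nonneg_iff_isPositive, ContinuousLinearMap.isPositive_iff_complex]
  intro u
  rw [← inner_conj_symm, inner_stateGenerated_self e hT, Complex.conj_ofReal]
  refine ⟨rfl, ?_⟩
  obtain ⟨l, hl, hl1, hT⟩ := hT
  refine mul_nonneg (inv_nonneg.2 Real.pi_pos.le) (setIntegral_nonneg
    ((measurableSet_argSet hX).prod measurableSet_Ioi) fun p hp => ?_)
  exact re_stateDensity_self_nonneg e hl hT u hp.2

lemma hasSum_inner_stateGenerated (hT : IsDiagonalState e T) {X : ℕ → Set Circle}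
    (hX : ∀ i, MeasurableSet[borel Circle] (X i))
    (hd : Pairwise fun i j => Disjoint (X i) (X j)) (u v : H) :
    HasSum (fun i => ⟪u, stateGenerated e T (X i) v⟫_ℂ) ⟪u, stateGenerated e T (⋃ i, X i) v⟫_ℂ := by
  simp_rw [inner_stateGenerated e hT]
  refine HasSum.mul_left _ ?_
  obtain ⟨l, hl, hl1, hT⟩ := hT
  have hi := integrableOn_stateDensity e hl hl1 hT u v (⋃ i, X i)
  rw [argSet_iUnion, iUnion_prod_const] at hi ⊢
  exact hasSum_integral_iUnion (fun i => (measurableSet_argSet (hX i)).prod measurableSet_Ioi)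
    (fun i j hij => (disjoint_argSet (hd hij)).set_prod_left _ _) hi

/-- Yields `E_T(X) ≤ I` from positivity at the complement, and is used again for sharpness. -/
lemma stateGenerated_compl (hT : IsDiagonalState e T) {X : Set Circle}
    (hX : MeasurableSet[borel Circle] X) :
    stateGenerated e T Xᶜ = 1 - stateGenerated e T X := by
  refine ContinuousLinearMap.ext fun v => ext_inner_left ℂ fun u => ?_
  rw [← stateGenerated_univ e hT, sub_apply, inner_sub_right,
    inner_stateGenerated e hT, inner_stateGenerated e hT, inner_stateGenerated e hT]
  obtain ⟨l, hl, hl1, hT⟩ := hT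
  have hi := integrableOn_stateDensity e hl hl1 hT u v
  have hu : argSet (univ : Set Circle) ×ˢ Ioi (0 : ℝ)
      = argSet X ×ˢ Ioi 0 ∪ argSet Xᶜ ×ˢ Ioi 0 := by
    rw [← union_prod]
    congr 1
    rw [argSet_eq, argSet_eq, argSet_eq, ← inter_union_distrib_left, ← preimage_union,
      union_compl_self]
  rw [hu, setIntegral_union ((disjoint_argSet disjoint_compl_right).set_prod_left _ _)
    ((measurableSet_argSet hX.compl).prod measurableSet_Ioi) (hi X) (hi Xᶜ)]
  ring

lemma isObservable_stateGenerated (hT : IsDiagonalState e T) : IsObservable (stateGenerated e T) where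
  nonneg _ hX := stateGenerated_nonneg e hT hX
  le_one X hX := by
    have h := stateGenerated_nonneg e hT hX.compl
    rw [stateGenerated_compl e hT hX] at h
    exact sub_nonneg.1 h
  univ := stateGenerated_univ e hT
  iUnion X hX hd := by
    rw [HasSum, ContinuousLinearMapWOT.tendsto_iff_forall_inner_apply_tendsto]
    intro v u
    have h := hasSum_inner_stateGenerated e hT hX hd u v
    rw [HasSum] at h
    refine h.congr fun S => ?_
    rw [← inner_sum]
    congr 1
    induction S using Finset.induction_on with
    | empty => simp
    | insert i S hi ih => rw [Finset.sum_insert hi, Finset.sum_insert hi, ih]; rfl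

lemma isPhaseObservable_stateGenerated (hT : IsDiagonalState e T) :
    IsPhaseObservable e (stateGenerated e T) where
  isObservable := isObservable_stateGenerated e hT
  covariant t X hX := by
    obtain ⟨l, hl, hl1, hT⟩ := hT
    refine ext_matrix_elements e fun m n => ?_
    rw [inner_stateGenerated_basis e hl hl1 hT, setIntegral_argSet_rotate t hX,
      ContinuousLinearMap.comp_apply, ContinuousLinearMap.comp_apply, adjoint_numberRep_apply,
      ← ContinuousLinearMap.adjoint_inner_left, adjoint_numberRep_apply, map_smul, inner_smul_left,
      inner_smul_right, inner_stateGenerated_basis e hl hl1 hT, map_pow, Complex.conj_conj]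
    ring

end PhaseObservable

/-! ### Uniqueness of the phase matrix and approximate sharpness -/

section Sharpness

open MeasureTheory Filter Topology Set

/-- On the open set where the character has positive real part, the integral has positive real part:
the set contains the point `1`, hence `argSet` of it contains some `(0, δ)`. Dividing by this
integral determines the entry of a phase matrix. -/
lemma exists_setIntegral_angular_ne_zero (m n : ℕ) :
    ∃ X : Set Circle, MeasurableSet[borel Circle] X ∧ ∫ θ in argSet X, angular m n θ ≠ 0 := by
  let f : Circle → ℝ := fun t => ((t : ℂ) ^ m * starRingEnd ℂ (t : ℂ) ^ n).re
  have hf : Continuous f := by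
    have := Complex.continuous_conj
    fun_prop
  have hX : IsOpen {t | 0 < f t} := isOpen_lt continuous_const hf
  have hXm : MeasurableSet[borel Circle] {t | 0 < f t} := MeasurableSpace.measurableSet_generateFrom hX
  refine ⟨_, hXm, fun h => ?_⟩
  have hfe : ∀ θ, f (Circle.exp θ) = (angular m n θ).re := fun θ => by rw [angular_eq_pow]
  have hint : IntegrableOn (angular m n) (argSet {t | 0 < f t}) :=
    ((continuous_angular m n).integrableOn_Icc (a := 0) (b := 2 * Real.pi)).mono_set
      fun θ hθ => Ico_subset_Icc_self hθ.1
  have hre : ∫ θ in argSet {t | 0 < f t}, (angular m n θ).re = 0 := by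
    have := integral_re hint
    simp only [RCLike.re_eq_complex_re] at this
    rw [this, h, Complex.zero_re]
  have hpos : 0 < ∫ θ in argSet {t | 0 < f t}, (angular m n θ).re := by
    rw [setIntegral_pos_iff_support_of_nonneg_ae]
    · have hU : IsOpen (Circle.exp ⁻¹' {t | 0 < f t} ∩ Iio (2 * Real.pi)) :=
        (hX.preimage Circle.exp.continuous).inter isOpen_Iio
      have h0 : (0 : ℝ) ∈ Circle.exp ⁻¹' {t | 0 < f t} ∩ Iio (2 * Real.pi) := by
        refine ⟨?_, Real.two_pi_pos⟩
        simp [f]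
      obtain ⟨δ, hδ, hball⟩ := Metric.isOpen_iff.1 hU 0 h0
      have hsub : Ioo 0 δ ⊆ Function.support (fun θ => (angular m n θ).re)
          ∩ argSet {t | 0 < f t} := by
        intro θ hθ
        have hm := hball (show θ ∈ Metric.ball (0 : ℝ) δ by
          rw [Metric.mem_ball, Real.dist_eq, sub_zero, abs_of_pos hθ.1]; exact hθ.2)
        refine ⟨?_, ⟨hθ.1.le, hm.2⟩, hm.1⟩
        have : 0 < f (Circle.exp θ) := hm.1
        rw [hfe] at this
        exact this.ne'
      refine lt_of_lt_of_le ?_ (measure_mono hsub)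
      rw [Real.volume_Ioo, sub_zero]
      exact ENNReal.ofReal_pos.2 hδ
    · filter_upwards [ae_restrict_mem (measurableSet_argSet hXm)] with θ hθ
      have : 0 < f (Circle.exp θ) := hθ.2
      rw [hfe] at this
      exact this.le
    · exact hint.re
  exact hpos.ne' hre

/-! ### Binomial vectors and concentration of phase at a point. -/

lemma norm_one_add_lt {w : ℂ} (hw : ‖w‖ = 1) (h1 : w ≠ 1) : ‖1 + w‖ ^ 2 < 4 := by
  have hn : w.re * w.re + w.im * w.im = 1 := by
    rw [← Complex.normSq_apply, Complex.normSq_eq_norm_sq, hw, one_pow]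
  rw [← Complex.normSq_eq_norm_sq, Complex.normSq_apply, Complex.add_re, Complex.add_im,
    Complex.one_re, Complex.one_im]
  have hre : w.re < 1 := by
    refine lt_of_le_of_ne (by nlinarith [mul_self_nonneg w.im]) fun h => h1 ?_
    rw [h] at hn
    exact Complex.ext h (by simpa using show w.im * w.im = 0 by linarith)
  nlinarith

/-- Away from `t₀` the function `|1 + t₀ conj t|²` is bounded away from `4`. -/
lemma exists_norm_one_add_le {X : Set Circle} (hX : IsOpen X) {t₀ : Circle} (ht₀ : t₀ ∈ X) :
    ∃ q : ℝ, 0 ≤ q ∧ q < 4 ∧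
      ∀ t ∈ Xᶜ, ‖1 + (t₀ : ℂ) * starRingEnd ℂ (t : ℂ)‖ ^ 2 ≤ q := by
  rcases (Xᶜ).eq_empty_or_nonempty with h | h
  · exact ⟨0, le_rfl, by norm_num, fun t ht => by simp [h] at ht⟩
  · have hc : IsCompact Xᶜ := hX.isClosed_compl.isCompact
    have hf : Continuous fun t : Circle => ‖1 + (t₀ : ℂ) * starRingEnd ℂ (t : ℂ)‖ ^ 2 := by
      have := Complex.continuous_conj
      fun_prop
    obtain ⟨s, hs, hmax⟩ := hc.exists_isMaxOn h hf.continuousOn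
    refine ⟨_, by positivity, norm_one_add_lt ?_ fun h1 => hs ?_, fun t ht => hmax ht⟩
    · rw [norm_mul, RCLike.norm_conj, Circle.norm_coe, Circle.norm_coe, one_mul]
    · rw [← Circle.coe_inv_eq_conj, ← Circle.coe_mul, Circle.coe_eq_one, mul_inv_eq_one] at h1
      rwa [← h1]

/-- Cauchy–Schwarz applied to `∑ (n choose j) = 2^n`. The polynomial loss `n + 1` is harmless
against the geometric gain `(q/4)^n`. -/
lemma four_pow_le_sum_choose_sq (n : ℕ) :
    (4 : ℝ) ^ n ≤ (n + 1) * ∑ j ∈ Finset.range (n + 1), (n.choose j : ℝ) ^ 2 := by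
  have h := sq_sum_le_card_mul_sum_sq (s := Finset.range (n + 1)) (f := fun j => (n.choose j : ℝ))
  have h2 : ∑ j ∈ Finset.range (n + 1), (n.choose j : ℝ) = 2 ^ n := by
    exact_mod_cast Nat.sum_range_choose n
  rw [h2, Finset.card_range, ← pow_mul, mul_comm n 2, pow_mul] at h
  norm_num at h
  exact h

variable {H : Type*} [NormedAddCommGroup H] [InnerProductSpace ℂ H]
variable (e : HilbertBasis ℕ ℂ H)

/-- The vector `∑_{j ≤ n} (n choose j) t₀^j |N + j⟩`. -/
noncomputable def binomialVec (n N : ℕ) (t₀ : Circle) : H :=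
  ∑ j ∈ Finset.range (n + 1), ((n.choose j : ℂ) * (t₀ : ℂ) ^ j) • e (N + j)

lemma norm_binomialVec_sq (n N : ℕ) (t₀ : Circle) :
    ‖binomialVec e n N t₀‖ ^ 2 = ∑ j ∈ Finset.range (n + 1), (n.choose j : ℝ) ^ 2 := by
  have ho : Orthonormal ℂ fun j => e (N + j) := e.orthonormal.comp _ (add_right_injective N)
  have h := ho.inner_sum (fun j => (n.choose j : ℂ) * (t₀ : ℂ) ^ j)
    (fun j => (n.choose j : ℂ) * (t₀ : ℂ) ^ j) (Finset.range (n + 1))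
  rw [← binomialVec, inner_self_eq_norm_sq_to_K] at h
  have h2 : ((‖binomialVec e n N t₀‖ ^ 2 : ℝ) : ℂ)
      = ((∑ j ∈ Finset.range (n + 1), (n.choose j : ℝ) ^ 2 : ℝ) : ℂ) := by
    rw [Complex.ofReal_sum, Complex.ofReal_pow]
    refine h.trans (Finset.sum_congr rfl fun j _ => ?_)
    rw [Complex.conj_mul', norm_mul, norm_pow, Circle.norm_coe, one_pow, mul_one,
      Complex.norm_natCast]
    norm_cast
  exact_mod_cast h2

variable [CompleteSpace H] {T : H →L[ℂ] H} {l : ℕ → ℝ}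

lemma eq_overlapMatrix_of_isPhaseMatrix (hl : ∀ n, 0 ≤ l n) (hl1 : HasSum l 1)
    (hT : HasSum (fun n => (l n : ℂ) • InnerProductSpace.rankOne ℂ (e n) (e n)) T)
    {c : Matrix ℕ ℕ ℂ} (hc : IsPhaseMatrix e (stateGenerated e T) c) : c = overlapMatrix l := by
  ext m n
  obtain ⟨X, hX, h0⟩ := exists_setIntegral_angular_ne_zero m n
  have h1 := hc.inner_eq m n X hX
  rw [inner_stateGenerated_basis e hl hl1 hT] at h1
  have h2 : ((2 * Real.pi : ℝ) : ℂ)⁻¹ ≠ 0 :=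
    inv_ne_zero (by exact_mod_cast Real.two_pi_pos.ne')
  exact (mul_right_cancel₀ h2 (mul_right_cancel₀ h0 h1)).symm

lemma inner_binomialVec (hl : ∀ n, 0 ≤ l n) (hl1 : HasSum l 1)
    (hT : HasSum (fun n => (l n : ℂ) • InnerProductSpace.rankOne ℂ (e n) (e n)) T)
    (X : Set Circle) (n N : ℕ) (t₀ : Circle) :
    ⟪binomialVec e n N t₀, stateGenerated e T X (binomialVec e n N t₀)⟫_ℂ
      = ∑ j ∈ Finset.range (n + 1), ∑ k ∈ Finset.range (n + 1),
        overlapMatrix l (N + j) (N + k) *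
          (starRingEnd ℂ ((n.choose j : ℂ) * (t₀ : ℂ) ^ j) * ((n.choose k : ℂ) * (t₀ : ℂ) ^ k)
            * (((2 * Real.pi : ℝ) : ℂ)⁻¹ * ∫ θ in argSet X, angular j k θ)) := by
  have hang : ∀ j k θ, angular (N + j) (N + k) θ = angular j k θ := fun j k θ => by
    rw [angular, angular]; congr 1; push_cast; ring
  rw [binomialVec, map_sum, sum_inner]
  refine Finset.sum_congr rfl fun j _ => ?_
  rw [inner_sum]
  refine Finset.sum_congr rfl fun k _ => ?_
  rw [map_smul, inner_smul_left, inner_smul_right, inner_stateGenerated_basis e hl hl1 hT]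
  simp only [hang]
  ring

lemma sum_angular_eq (n : ℕ) (t₀ : Circle) (θ : ℝ) :
    ∑ j ∈ Finset.range (n + 1), ∑ k ∈ Finset.range (n + 1),
      starRingEnd ℂ ((n.choose j : ℂ) * (t₀ : ℂ) ^ j) * ((n.choose k : ℂ) * (t₀ : ℂ) ^ k)
        * angular j k θ
      = (((‖1 + (t₀ : ℂ) * starRingEnd ℂ (Circle.exp θ : ℂ)‖ ^ 2) ^ n : ℝ) : ℂ) := by
  set w := (t₀ : ℂ) * starRingEnd ℂ (Circle.exp θ : ℂ) with hw
  have h1 : (1 + w) ^ n = ∑ k ∈ Finset.range (n + 1), (n.choose k : ℂ) * w ^ k := by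
    rw [add_comm, add_pow]
    refine Finset.sum_congr rfl fun k _ => ?_
    rw [one_pow, mul_one, mul_comm]
  rw [← pow_mul, mul_comm 2 n, pow_mul, ← norm_pow]
  push_cast
  rw [← Complex.conj_mul', h1, map_sum, Finset.sum_mul_sum]
  refine Finset.sum_congr rfl fun j _ => Finset.sum_congr rfl fun k _ => ?_
  rw [angular_eq_pow, hw]
  simp only [map_mul, map_pow, map_natCast, Complex.conj_conj]
  ring

/-- Shifting by `N` leaves the angular factors unchanged and affects only the entries of the overlap
matrix, which tend to `1`. What remains is the binomial expansion of `|1 + t₀ conj t|^{2n}`. -/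
lemma tendsto_inner_binomialVec (hl : ∀ n, 0 ≤ l n) (hl1 : HasSum l 1)
    (hT : HasSum (fun n => (l n : ℂ) • InnerProductSpace.rankOne ℂ (e n) (e n)) T)
    (X : Set Circle) (n : ℕ) (t₀ : Circle) :
    Tendsto (fun N => ⟪binomialVec e n N t₀, stateGenerated e T X (binomialVec e n N t₀)⟫_ℂ) atTop
      (𝓝 (((2 * Real.pi)⁻¹ * ∫ θ in argSet X,
        (‖1 + (t₀ : ℂ) * starRingEnd ℂ (Circle.exp θ : ℂ)‖ ^ 2) ^ n : ℝ) : ℂ)) := by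
  simp_rw [inner_binomialVec e hl hl1 hT]
  have h := tendsto_finsetSum (Finset.range (n + 1)) fun j _ =>
    tendsto_finsetSum (Finset.range (n + 1)) fun k _ =>
      (tendsto_overlapMatrix_add hl hl1 j k).mul_const
        (starRingEnd ℂ ((n.choose j : ℂ) * (t₀ : ℂ) ^ j) * ((n.choose k : ℂ) * (t₀ : ℂ) ^ k)
            * (((2 * Real.pi : ℝ) : ℂ)⁻¹ * ∫ θ in argSet X, angular j k θ))
  convert h using 2
  have hint : ∀ j k : ℕ, IntegrableOn (fun θ => starRingEnd ℂ ((n.choose j : ℂ) * (t₀ : ℂ) ^ j) *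
      ((n.choose k : ℂ) * (t₀ : ℂ) ^ k) * angular j k θ) (argSet X) := fun j k =>
    (((continuous_angular j k).integrableOn_Icc (a := 0) (b := 2 * Real.pi)).mono_set
      fun θ hθ => Ico_subset_Icc_self hθ.1).const_mul _
  rw [Complex.ofReal_mul, ← integral_complex_ofReal, Complex.ofReal_inv]
  simp_rw [← sum_angular_eq]
  rw [integral_finsetSum _ fun j _ => integrable_finsetSum _ fun k _ => hint j k, Finset.mul_sum]
  refine Finset.sum_congr rfl fun j _ => ?_
  rw [integral_finsetSum _ fun k _ => hint j k, Finset.mul_sum]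
  refine Finset.sum_congr rfl fun k _ => ?_
  rw [integral_const_mul]
  ring

lemma stateGenerated_empty (hT : IsDiagonalState e T) : stateGenerated e T ∅ = 0 := by
  refine ContinuousLinearMap.ext fun v => ext_inner_left ℂ fun u => ?_
  rw [inner_stateGenerated e hT, argSet_empty]
  simp

lemma isApproximatelySharp_stateGenerated (hT : IsDiagonalState e T) :
    IsApproximatelySharp (stateGenerated e T) := by
  intro X hX hne
  have hXm : MeasurableSet[borel Circle] X := MeasurableSpace.measurableSet_generateFrom hX
  have hobs := isObservable_stateGenerated e hT
  set A := stateGenerated e T X with hA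
  have hle : ‖A‖ ≤ 1 :=
    (CStarAlgebra.norm_le_one_iff_of_nonneg A (hobs.nonneg X hXm)).2 (hobs.le_one X hXm)
  refine le_antisymm hle ?_
  -- A nonzero effect is needed only to exclude the empty set.
  obtain ⟨t₀, ht₀⟩ : X.Nonempty := by
    rw [nonempty_iff_ne_empty]
    rintro rfl
    exact hne (stateGenerated_empty e hT)
  obtain ⟨q, hq0, hq4, hq⟩ := exists_norm_one_add_le hX ht₀
  have hcompl := stateGenerated_compl e hT hXm
  obtain ⟨l, hl, hl1, hT'⟩ := id hT
  -- For a binomial vector `ψ`, `(1 - ‖A‖) ‖ψ‖² ≤ ⟨ψ, E_T(Xᶜ) ψ⟩`, and `‖ψ‖` does not depend on `N`.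
  -- So `N → ∞` is taken first with `n` fixed; `n → ∞` follows in `hfinal`.
  have hbound : ∀ n : ℕ, (1 - ‖A‖) * ∑ j ∈ Finset.range (n + 1), (n.choose j : ℝ) ^ 2 ≤ q ^ n := by
    intro n
    have hlim := (Complex.continuous_re.tendsto _).comp
      (tendsto_inner_binomialVec e hl hl1 hT' Xᶜ n t₀)
    rw [Complex.ofReal_re] at hlim
    have h1 : (1 - ‖A‖) * ∑ j ∈ Finset.range (n + 1), (n.choose j : ℝ) ^ 2
        ≤ (2 * Real.pi)⁻¹ * ∫ θ in argSet Xᶜ,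
          (‖1 + (t₀ : ℂ) * starRingEnd ℂ (Circle.exp θ : ℂ)‖ ^ 2) ^ n := by
      refine ge_of_tendsto' hlim fun N => ?_
      simp only [Function.comp]
      set ψ := binomialVec e n N t₀ with hψ
      rw [hcompl, sub_apply, one_apply_eq_self, inner_sub_right, Complex.sub_re,
        inner_self_eq_norm_sq_to_K]
      have h2 : (⟪ψ, A ψ⟫_ℂ).re ≤ ‖A‖ * ‖ψ‖ ^ 2 := by
        refine (Complex.re_le_norm _).trans ((norm_inner_le_norm _ _).trans ?_)
        nlinarith [A.le_opNorm ψ, norm_nonneg ψ]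
      have h3 : (((‖ψ‖ : ℝ) : ℂ) ^ 2).re = ‖ψ‖ ^ 2 := by norm_cast
      have h4 := norm_binomialVec_sq e n N t₀
      rw [← hψ] at h4
      simp only [Complex.coe_algebraMap]
      rw [h3, ← h4]
      linarith
    refine h1.trans ?_
    have hfin : volume (argSet Xᶜ) ≤ ENNReal.ofReal (2 * Real.pi) := by
      refine (measure_mono (show argSet Xᶜ ⊆ Ico 0 (2 * Real.pi) from fun _ h => h.1)).trans ?_
      rw [Real.volume_Ico, sub_zero]
    have h5 := norm_setIntegral_le_of_norm_le_const (μ := volume) (s := argSet Xᶜ) (C := q ^ n)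
      (f := fun θ => (‖1 + (t₀ : ℂ) * starRingEnd ℂ (Circle.exp θ : ℂ)‖ ^ 2) ^ n)
      (hfin.trans_lt ENNReal.ofReal_lt_top) (fun θ hθ => by
        rw [Real.norm_of_nonneg (by positivity)]
        exact pow_le_pow_left₀ (by positivity) (hq _ hθ.2) n)
    have h6 : volume.real (argSet Xᶜ) ≤ 2 * Real.pi :=
      ENNReal.toReal_le_of_le_ofReal Real.two_pi_pos.le hfin
    rw [inv_mul_le_iff₀ Real.two_pi_pos]
    calc _ ≤ q ^ n * volume.real (argSet Xᶜ) := (Real.le_norm_self _).trans h5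
      _ ≤ q ^ n * (2 * Real.pi) := by gcongr
      _ = _ := mul_comm _ _
  have hdecay : Tendsto (fun n : ℕ => (n : ℝ) * (q / 4) ^ n + (q / 4) ^ n) atTop (𝓝 0) := by
    have h1 : q / 4 < 1 := by linarith
    have h0 : 0 ≤ q / 4 := by positivity
    simpa using (tendsto_self_mul_const_pow_of_lt_one h0 h1).add
      (tendsto_pow_atTop_nhds_zero_of_lt_one h0 h1)
  have hfinal : 1 - ‖A‖ ≤ 0 := by
    refine ge_of_tendsto' hdecay fun n => ?_
    have h1 := four_pow_le_sum_choose_sq n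
    have h2 := hbound n
    have h4 : (0 : ℝ) < 4 ^ n := by positivity
    have h5 : (n : ℝ) * (q / 4) ^ n + (q / 4) ^ n = (n + 1) * q ^ n / 4 ^ n := by
      rw [div_pow]; ring
    rw [h5, le_div_iff₀ h4]
    calc (1 - ‖A‖) * 4 ^ n
        ≤ (1 - ‖A‖) * ((n + 1) * ∑ j ∈ Finset.range (n + 1), (n.choose j : ℝ) ^ 2) :=
          mul_le_mul_of_nonneg_left h1 (by linarith)
      _ = (n + 1) * ((1 - ‖A‖) * ∑ j ∈ Finset.range (n + 1), (n.choose j : ℝ) ^ 2) := by ring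
      _ ≤ (n + 1) * q ^ n := by gcongr
  linarith

end Sharpness

end PhaseObs

theorem mainTheorem12 {H : Type*} [NormedAddCommGroup H] [InnerProductSpace ℂ H] [CompleteSpace H]
    (e : HilbertBasis ℕ ℂ H) (T : H →L[ℂ] H) (hT : PhaseObs.IsDiagonalState e T) :
    (∀ X : Set Circle, MeasurableSet[borel Circle] X →
      PhaseObs.IsStateIntegral e T X (PhaseObs.stateGenerated e T X)) ∧
    PhaseObs.IsPhaseObservable e (PhaseObs.stateGenerated e T) ∧
    PhaseObs.IsApproximatelySharp (PhaseObs.stateGenerated e T) ∧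
    (∃ c : Matrix ℕ ℕ ℂ, PhaseObs.IsPhaseMatrix e (PhaseObs.stateGenerated e T) c) ∧
    (∀ c : Matrix ℕ ℕ ℂ, PhaseObs.IsPhaseMatrix e (PhaseObs.stateGenerated e T) c →
      ∀ k : ℕ, Filter.Tendsto (fun m : ℕ => c m (m + k)) Filter.atTop (nhds 1)) := by
  obtain ⟨l, hl, hl1, hT'⟩ := id hT
  refine ⟨fun X _ => PhaseObs.isStateIntegral_stateGenerated e hT X,
    PhaseObs.isPhaseObservable_stateGenerated e hT,
    PhaseObs.isApproximatelySharp_stateGenerated e hT,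
    ⟨_, PhaseObs.isPhaseMatrix_overlapMatrix e hl hl1 hT'⟩, fun c hc k => ?_⟩
  rw [PhaseObs.eq_overlapMatrix_of_isPhaseMatrix e hl hl1 hT' hc]
  exact PhaseObs.tendsto_overlapMatrix hl hl1 k
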